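/- Let $A_2=\{a,b\}$, let $A_2^{-1}=\{a^{-1},b^{-1}\}$ be a disjoint set of formal inverses, put $\tilde A_2=A_2\cup A_2^{-1}$, and let $F_2$ be the free group on $A_2$. An element of $F_2$ is \emph{primitive} if it belongs to some basis of $F_2$ (a subset $B\subseteq F_2$ such that the homomorphism from the free group on $B$ to $F_2$ induced by the inclusion $B\to F_2$ is an isomorphism). Let $P_2\subseteq F_2$ be the set of primitive elements, and let $\overline{P_2}\subseteq\tilde A_2^*$ be the set of the reduced words that represent the elements of $P_2$. A \emph{context-sensitive grammar} over a finite alphabet $A$ is a triple $(V,P,S)$ where $V$ is a finite set containing $A$, $S\in V\setminus A$, and $P$ is a finite set of pairs $(\ell,r)\in V^+\times V^+$ with $\ell\notin A^+$ and $|\ell|\le|r|$. Write $x\Rightarrow y$ if $x=u\ell v$ and $y=urv$ for some $u,v\in V^*$ and $(\ell,r)\in P$, and let $\Rightarrow^*$ be the reflexive and transitive closure of $\Rightarrow$. The language generated by the grammar is $\{w\in A^+ : S\Rightarrow^* w\}$. A language $L\subseteq A^*$ is \emph{context-sensitive} if $L\cap A^+$ is generated by some context-sensitive grammar over $A$. \textbf{Theorem.}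 The language $\overline{P_2}\subseteq\tilde A_2^*$ is context-sensitive. -/

import Mathlib

/-- A context-sensitive (length-nondecreasing) grammar over a finite alphabet `T` of terminals.
The total alphabet `V` is `Symbol T NT`, the disjoint union of `T` and the finite set `NT`. -/
structure ContextSensitiveGrammar (T : Type*) where
  /-- The symbols of the grammar that are not terminals. -/
  NT : Type
  finite_NT : Finite NT
  /-- The start symbol. -/
  initial : NT
  /-- The finite set of rules `(ℓ, r)`. -/
  rules : Finset (List (Symbol T NT) × List (Symbol T NT))
  /-- No left-hand side is a word over the terminals (in particular none is empty). -/
  exists_nonterminal : ∀ p ∈ rules, ∃ n : NT, Symbol.nonterminal n ∈ p.1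
  /-- No rule decreases the length (in particular no right-hand side is empty). -/
  length_le : ∀ p ∈ rules, p.1.length ≤ p.2.length

namespace ContextSensitiveGrammar

variable {T : Type*}

/-- One rewriting step `uℓv ⇒ urv`, where `(ℓ, r)` is a rule. -/
def Produces (g : ContextSensitiveGrammar T) (x y : List (Symbol T g.NT)) : Prop :=
  ∃ p ∈ g.rules, ∃ u v : List (Symbol T g.NT), x = u ++ p.1 ++ v ∧ y = u ++ p.2 ++ v

/-- The reflexive and transitive closure of the one-step relation. -/
def Derives (g : ContextSensitiveGrammar T) :
    List (Symbol T g.NT) → List (Symbol T g.NT) → Prop :=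
  Relation.ReflTransGen g.Produces

/-- The generated language: all non-empty terminal words derivable from the start symbol. -/
def language (g : ContextSensitiveGrammar T) : Language T :=
  {w : List T | w ≠ [] ∧ g.Derives [Symbol.nonterminal g.initial] (w.map Symbol.terminal)}

end ContextSensitiveGrammar

/-- A language is context-sensitive if the set of its non-empty words is generated by a
context-sensitive grammar. -/
def Language.IsContextSensitive {T : Type*} (L : Language T) : Prop :=
  ∃ g : ContextSensitiveGrammar T, g.language = {w : List T | w ∈ L ∧ w ≠ []}

/-- An element of a group is primitive if it belongs to some basis, that is, a subset `B` such that the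
inclusion of `B` extends to an isomorphism from the free group on `B`. -/
def IsPrimitiveElement {G : Type*} [Group G] (x : G) : Prop :=
  ∃ B : Set G, (∃ b : FreeGroupBasis B G, ∀ y : B, b y = y) ∧ x ∈ B

/-- The language, over the alphabet of the two generators and their formal inverses, of the
reduced words that represent the primitive elements of the free group of rank two;
the letter `(i, true)` is the generator `i` and `(i, false)` its inverse. -/
def reducedPrimitiveWords : Language (Fin 2 × Bool) :=
  {w : List (Fin 2 × Bool) | ∃ x : FreeGroup (Fin 2), IsPrimitiveElement x ∧ x.toWord = w}

section Rewriting

variable {T Γ : Type}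

/-- One step `uℓv ⇒ urv` of the string rewriting system with rules `R ℓ r`. -/
def RewriteStep (R : List Γ → List Γ → Prop) (x y : List Γ) : Prop :=
  ∃ l r u v, R l r ∧ x = u ++ l ++ v ∧ y = u ++ r ++ v

theorem RewriteStep.append {R : List Γ → List Γ → Prop} {x y : List Γ} (h : RewriteStep R x y)
    (a b : List Γ) : RewriteStep R (a ++ x ++ b) (a ++ y ++ b) := by
  obtain ⟨l, r, u, v, h, rfl, rfl⟩ := h
  exact ⟨l, r, a ++ u, v ++ b, h, by simp, by simp⟩

/-- The nonterminals of the compressed grammar: a block of `k` symbols, or a single symbol. -/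
abbrev CompressedSymbol (Γ : Type) (k : ℕ) : Type := {c : List Γ // c.length = k} ⊕ Γ

/-- The symbol of the compressed grammar holding a block of `k` symbols. -/
abbrev blockSymbol {k : ℕ} (c : {c : List Γ // c.length = k}) : Symbol T (CompressedSymbol Γ k) :=
  .nonterminal (.inl c)

/-- The symbol of the compressed grammar holding one symbol. -/
abbrev singleSymbol {k : ℕ} (x : Γ) : Symbol T (CompressedSymbol Γ k) :=
  .nonterminal (.inr x)

/-- The rules of the grammar that simulates a rewriting system, storing the first `k` symbols of a
word in one symbol; the block `pre ++ [t]` may be turned into the letter `t`. -/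
inductive CompressedRule (R : List Γ → List Γ → Prop) (emb : T → Γ) (pre : List Γ) (N k : ℕ) :
    List (Symbol T (CompressedSymbol Γ k)) → List (Symbol T (CompressedSymbol Γ k)) → Prop
  | inner {l r} : R l r → l ≠ [] → l.length ≤ r.length → r.length ≤ N →
      CompressedRule R emb pre N k (l.map singleSymbol) (r.map singleSymbol)
  | block {c c' y y'} : RewriteStep R (c.1 ++ y) (c'.1 ++ y') → y.length ≤ y'.length →
      y'.length ≤ N + N → CompressedRule R emb pre N k
        (blockSymbol c :: y.map singleSymbol) (blockSymbol c' :: y'.map singleSymbol)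
  | letter (t : T) : CompressedRule R emb pre N k [singleSymbol (emb t)] [.terminal t]
  | last {t : T} {c} : c.1 = pre ++ [emb t] →
      CompressedRule R emb pre N k [blockSymbol c] [.terminal t]

theorem CompressedRule.length_le {R : List Γ → List Γ → Prop} {emb : T → Γ} {pre : List Γ}
    {N k : ℕ} {x y} (h : CompressedRule R emb pre N k x y) :
    x.length ≤ y.length ∧ y.length ≤ N + N + 1 := by
  cases h with
  | inner _ _ _ _ => simp; omega
  | block _ _ _ => simp; omega
  | letter t => simp
  | last _ => simp

theorem CompressedRule.exists_nonterminal {R : List Γ → List Γ → Prop} {emb : T → Γ}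
    {pre : List Γ} {N k : ℕ} {x y} (h : CompressedRule R emb pre N k x y) :
    ∃ n, Symbol.nonterminal n ∈ x := by
  cases h with
  | inner _ h _ _ =>
    obtain ⟨a, ha⟩ := List.exists_mem_of_ne_nil _ h
    exact ⟨.inr a, List.mem_map_of_mem ha⟩
  | block _ _ _ => exact ⟨_, List.mem_cons_self⟩
  | letter t => exact ⟨_, List.mem_cons_self⟩
  | last _ => exact ⟨_, List.mem_cons_self⟩

/-- The grammar that simulates a rewriting system on words whose first symbols are stored in one
block. -/
noncomputable def compressedGrammar [Finite T] [Finite Γ] (R : List Γ → List Γ → Prop)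
    (emb : T → Γ) (pre : List Γ) (N k : ℕ) (start : {c : List Γ // c.length = k}) :
    ContextSensitiveGrammar T where
  NT := CompressedSymbol Γ k
  finite_NT := by
    have : Finite {c : List Γ // c.length = k} := (List.finite_length_eq Γ k).to_subtype
    infer_instance
  initial := .inl start
  rules := Set.Finite.toFinset (s := {p | CompressedRule R emb pre N k p.1 p.2}) (by
    have : Finite {c : List Γ // c.length = k} := (List.finite_length_eq Γ k).to_subtype
    have := Fintype.ofFinite T
    have := Fintype.ofFinite (CompressedSymbol Γ k)
    refine ((List.finite_length_le (Symbol T (CompressedSymbol Γ k)) (N + N + 1)).prod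
      (List.finite_length_le _ (N + N + 1))).subset ?_
    intro p hp
    have := CompressedRule.length_le hp
    exact ⟨this.1.trans this.2, this.2⟩)
  exists_nonterminal := by
    intro p hp
    exact CompressedRule.exists_nonterminal (by simpa using hp)
  length_le := by
    intro p hp
    exact (CompressedRule.length_le (by simpa using hp)).1

/-- The word over `Γ` that is represented by a symbol of the compressed grammar. -/
def decodeSymbol {k : ℕ} (emb : T → Γ) : Symbol T (CompressedSymbol Γ k) → List Γ
  | .terminal t => [emb t]
  | .nonterminal (.inl c) => c.1
  | .nonterminal (.inr x) => [x]

/-- A sentential form of the compressed grammar without block symbols. -/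
def BlockFree {k : ℕ} (z : List (Symbol T (CompressedSymbol Γ k))) : Prop :=
  ∀ c, blockSymbol c ∉ z

theorem flatMap_decodeSymbol_singles {k : ℕ} (emb : T → Γ) (y : List Γ) :
    (y.map (singleSymbol (T := T) (k := k))).flatMap (decodeSymbol emb) = y := by
  induction y with
  | nil => rfl
  | cons a y ih => simp [decodeSymbol, ih]

theorem flatMap_decodeSymbol_terminals {k : ℕ} (emb : T → Γ) (w : List T) :
    (w.map (Symbol.terminal (N := CompressedSymbol Γ k))).flatMap (decodeSymbol emb) =
      w.map emb := by
  induction w with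
  | nil => rfl
  | cons a y ih => simp [decodeSymbol, ih]

theorem blockFree_singles {k : ℕ} (y : List Γ) :
    BlockFree (y.map (singleSymbol (T := T) (k := k))) := by
  intro c h
  simp at h

theorem BlockFree.append {k : ℕ} {x y : List (Symbol T (CompressedSymbol Γ k))}
    (hx : BlockFree x) (hy : BlockFree y) : BlockFree (x ++ y) := by
  intro c h
  rcases List.mem_append.1 h with h | h
  exacts [hx c h, hy c h]

theorem BlockFree.of_append {k : ℕ} {x y : List (Symbol T (CompressedSymbol Γ k))}
    (h : BlockFree (x ++ y)) : BlockFree x ∧ BlockFree y :=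
  ⟨fun c hc => h c (by simp [hc]), fun c hc => h c (by simp [hc])⟩

theorem eq_nil_of_block_append {k : ℕ} {u v rest : List (Symbol T (CompressedSymbol Γ k))}
    {c c' : {c : List Γ // c.length = k}} (hrest : BlockFree rest)
    (h : blockSymbol c :: rest = u ++ blockSymbol c' :: v) : u = [] ∧ c = c' ∧ rest = v := by
  cases u with
  | nil => simpa using h
  | cons a u =>
    simp only [List.cons_append, List.cons.injEq] at h
    exact absurd (by rw [h.2]; simp) (hrest c')

/-- The invariant of the derivations of the compressed grammar. -/
def CompressedInvariant {k : ℕ} (R : List Γ → List Γ → Prop) (emb : T → Γ) (start pre : List Γ)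
    (z : List (Symbol T (CompressedSymbol Γ k))) : Prop :=
  (∃ c rest, z = blockSymbol c :: rest ∧ BlockFree rest ∧
    Relation.ReflTransGen (RewriteStep R) start (c.1 ++ rest.flatMap (decodeSymbol emb))) ∨
  (BlockFree z ∧
    Relation.ReflTransGen (RewriteStep R) start (pre ++ z.flatMap (decodeSymbol emb)))

/-- Replacing a block-free part by another one preserves the invariant. -/
theorem CompressedInvariant.replace {k : ℕ} {R : List Γ → List Γ → Prop} {emb : T → Γ}
    {start pre : List Γ} {u x y v : List (Symbol T (CompressedSymbol Γ k))}
    (h : CompressedInvariant R emb start pre (u ++ x ++ v)) (hx0 : x ≠ []) (hx : BlockFree x)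
    (hy : BlockFree y)
    (hxy : Relation.ReflTransGen (RewriteStep R) (x.flatMap (decodeSymbol emb))
      (y.flatMap (decodeSymbol emb))) :
    CompressedInvariant R emb start pre (u ++ y ++ v) := by
  have key (a b : List Γ) : Relation.ReflTransGen (RewriteStep R)
      (a ++ x.flatMap (decodeSymbol emb) ++ b) (a ++ y.flatMap (decodeSymbol emb) ++ b) := by
    refine hxy.lift (fun z => a ++ z ++ b) ?_
    intro p q hpq
    exact hpq.append a b
  rcases h with ⟨c, rest, hz, hrest, hr⟩ | ⟨hz, hr⟩
  · left
    cases u with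
    | nil =>
      cases x with
      | nil => exact absurd rfl hx0
      | cons s x =>
        simp only [List.nil_append, List.cons_append, List.cons.injEq] at hz
        exact absurd (by simp [hz.1]) (hx c)
    | cons s u =>
      simp only [List.cons_append, List.cons.injEq] at hz
      obtain ⟨rfl, rfl⟩ := hz
      have h1 := hrest.of_append
      refine ⟨c, u ++ y ++ v, rfl, (h1.1.of_append.1.append hy).append h1.2, hr.trans ?_⟩
      simpa using key (c.1 ++ u.flatMap (decodeSymbol emb)) (v.flatMap (decodeSymbol emb))
  · right
    have h1 := hz.of_append
    refine ⟨(h1.1.of_append.1.append hy).append h1.2, hr.trans ?_⟩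
    simpa using key (pre ++ u.flatMap (decodeSymbol emb)) (v.flatMap (decodeSymbol emb))

theorem CompressedInvariant.step {k : ℕ} {R : List Γ → List Γ → Prop} {emb : T → Γ}
    {start pre : List Γ} {N : ℕ} {u x y v : List (Symbol T (CompressedSymbol Γ k))}
    (h : CompressedInvariant R emb start pre (u ++ x ++ v))
    (hxy : CompressedRule R emb pre N k x y) :
    CompressedInvariant R emb start pre (u ++ y ++ v) := by
  cases hxy with
  | inner hR h0 _ _ =>
    refine h.replace (by simpa using h0) (blockFree_singles _) (blockFree_singles _) ?_
    rw [flatMap_decodeSymbol_singles, flatMap_decodeSymbol_singles]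
    exact .single ⟨_, _, [], [], hR, by simp, by simp⟩
  | @block c c' y y' hs _ _ =>
    rcases h with ⟨d, rest, hz, hrest, hr⟩ | ⟨hz, _⟩
    · left
      obtain ⟨rfl, rfl, rfl⟩ := eq_nil_of_block_append hrest
        (hz.symm.trans (by simp : _ = u ++ blockSymbol c :: (y.map singleSymbol ++ v)))
      refine ⟨c', y'.map singleSymbol ++ v, by simp,
        (blockFree_singles _).append hrest.of_append.2, hr.trans (.single ?_)⟩
      rw [List.flatMap_append, List.flatMap_append, flatMap_decodeSymbol_singles,
        flatMap_decodeSymbol_singles]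
      simpa using hs.append [] (v.flatMap (decodeSymbol emb))
    · exact absurd (by simp) (hz c)
  | letter t =>
    exact h.replace (by simp) (blockFree_singles [emb t]) (by intro c h; simp at h)
      (by simpa [decodeSymbol] using .refl)
  | @last t c hc =>
    rcases h with ⟨d, rest, hz, hrest, hr⟩ | ⟨hz, _⟩
    · right
      obtain ⟨rfl, rfl, rfl⟩ := eq_nil_of_block_append hrest
        (hz.symm.trans (by simp : _ = u ++ blockSymbol c :: v))
      refine ⟨BlockFree.append (by intro c h; simp at h) hrest, ?_⟩
      simpa [decodeSymbol, hc] using hr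
    · exact absurd (by simp) (hz c)

section Grammar

variable {R : List Γ → List Γ → Prop} {emb : T → Γ} {pre : List Γ} {N k : ℕ}

theorem compressedGrammar_derives_iff [Finite T] [Finite Γ]
    {start : {c : List Γ // c.length = k}} {x y : List (Symbol T (CompressedSymbol Γ k))} :
    (compressedGrammar R emb pre N k start).Derives x y ↔
      Relation.ReflTransGen (RewriteStep (CompressedRule R emb pre N k)) x y := by
  have : (compressedGrammar R emb pre N k start).Produces =
      RewriteStep (CompressedRule R emb pre N k) := by
    ext x y
    constructor
    · rintro ⟨p, hp, u, v, rfl, rfl⟩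
      exact ⟨p.1, p.2, u, v, (Set.Finite.mem_toFinset (a := p) _).1 hp, rfl, rfl⟩
    · rintro ⟨l, r, u, v, h, rfl, rfl⟩
      exact ⟨(l, r), (Set.Finite.mem_toFinset (a := (l, r)) _).2 h, u, v, rfl, rfl⟩
  rw [ContextSensitiveGrammar.Derives, this]
  rfl

theorem CompressedInvariant.of_reflTransGen {start : {c : List Γ // c.length = k}}
    {z : List (Symbol T (CompressedSymbol Γ k))}
    (h : Relation.ReflTransGen (RewriteStep (CompressedRule R emb pre N k)) [blockSymbol start] z) :
    CompressedInvariant R emb start.1 pre z := by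
  induction h with
  | refl => exact .inl ⟨start, [], rfl, fun _ h => by simp at h, by simpa using .refl⟩
  | tail _ hs ih =>
    obtain ⟨l, r, u, v, h, rfl, rfl⟩ := hs
    exact ih.step h

/-- A rewriting step is simulated by one step of the compressed grammar. -/
theorem compressedRule_simulates
    (hR : ∀ l r, R l r → l ≠ [] ∧ l.length ≤ r.length ∧ r.length ≤ N)
    (c : {c : List Γ // c.length = k}) (rest z : List Γ)
    (h : RewriteStep R (c.1 ++ rest) z) :
    ∃ (c' : {c : List Γ // c.length = k}) (rest' : List Γ), z = c'.1 ++ rest' ∧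
      RewriteStep (CompressedRule R emb pre N k)
        (blockSymbol c :: rest.map singleSymbol) (blockSymbol c' :: rest'.map singleSymbol) := by
  obtain ⟨l, r, u, v, hlr, hx, rfl⟩ := h
  obtain ⟨h0, h1, h2⟩ := hR l r hlr
  have hc := c.2
  by_cases hu : k ≤ u.length
  · obtain ⟨u', rfl⟩ : c.1 <+: u := List.prefix_of_prefix_length_le (l₃ := c.1 ++ rest)
      (List.prefix_append _ _) (by rw [hx]; simp) (by omega)
    have hrest : rest = u' ++ l ++ v := by simpa using hx
    refine ⟨c, u' ++ r ++ v, by simp, _, _, blockSymbol c :: u'.map singleSymbol,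
      v.map singleSymbol, .inner hlr h0 h1 h2, ?_, ?_⟩
    · rw [hrest]; simp only [List.map_append, List.cons_append]
    · simp only [List.map_append, List.cons_append]
  · obtain ⟨v1, hv1⟩ : u ++ l <+: c.1 ++ rest.take N := by
      refine List.prefix_of_prefix_length_le (l₃ := c.1 ++ rest) (by rw [hx]; simp)
        ((List.prefix_append_right_inj _).2 (List.take_prefix _ _)) ?_
      have := congrArg List.length hx
      simp at this ⊢
      omega
    have hv : v = v1 ++ rest.drop N := by
      have : u ++ l ++ v = u ++ l ++ (v1 ++ rest.drop N) := by
        rw [← hx, ← List.append_assoc, hv1]; simp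
      simpa using this
    have hlen := congrArg List.length hv1
    simp only [List.length_append, List.length_take] at hlen
    have hk : ((u ++ r ++ v1).take k).length = k := by simp; omega
    refine ⟨⟨(u ++ r ++ v1).take k, hk⟩, (u ++ r ++ v1).drop k ++ rest.drop N, ?_,
      blockSymbol c :: (rest.take N).map singleSymbol, blockSymbol ⟨(u ++ r ++ v1).take k, hk⟩ ::
        ((u ++ r ++ v1).drop k).map singleSymbol, [], (rest.drop N).map singleSymbol, ?_, ?_, ?_⟩
    · rw [← List.append_assoc, List.take_append_drop, hv]; simp
    · refine .block ⟨l, r, u, v1, hlr, hv1.symm, ?_⟩ ?_ ?_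
      · simp only [List.take_append_drop]
      · simp; omega
      · simp; omega
    · simp only [List.nil_append, List.cons_append, ← List.map_append, List.take_append_drop]
    · simp only [List.nil_append, List.cons_append, ← List.map_append]

theorem compressedRule_reflTransGen
    (hR : ∀ l r, R l r → l ≠ [] ∧ l.length ≤ r.length ∧ r.length ≤ N)
    {start : {c : List Γ // c.length = k}} {z : List Γ}
    (h : Relation.ReflTransGen (RewriteStep R) start.1 z) :
    ∃ (c : {c : List Γ // c.length = k}) (rest : List Γ), z = c.1 ++ rest ∧
      Relation.ReflTransGen (RewriteStep (CompressedRule R emb pre N k)) [blockSymbol start]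
        (blockSymbol c :: rest.map singleSymbol) := by
  induction h with
  | refl => exact ⟨start, [], by simp, .refl⟩
  | tail _ hs ih =>
    obtain ⟨c, rest, rfl, hd⟩ := ih
    obtain ⟨c', rest', rfl, hp⟩ :=
      compressedRule_simulates (emb := emb) (pre := pre) hR c rest _ hs
    exact ⟨c', rest', rfl, hd.tail hp⟩

theorem compressedRule_terminals (u : List (Symbol T (CompressedSymbol Γ k))) (w : List T) :
    Relation.ReflTransGen (RewriteStep (CompressedRule R emb pre N k))
      (u ++ (w.map emb).map singleSymbol) (u ++ w.map .terminal) := by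
  induction w generalizing u with
  | nil => exact .refl
  | cons t w ih =>
    refine .head (b := u ++ [.terminal t] ++ (w.map emb).map singleSymbol)
      ⟨_, _, u, (w.map emb).map singleSymbol, .letter t, by simp, rfl⟩ ?_
    have h2 := ih (u ++ [.terminal t])
    rwa [List.append_assoc u [_] (w.map _)] at h2

theorem compressedRule_terminals_iff
    (hR : ∀ l r, R l r → l ≠ [] ∧ l.length ≤ r.length ∧ r.length ≤ N)
    {start : {c : List Γ // c.length = k}} (hk : k = pre.length + 1) {w : List T} (hw : w ≠ []) :
    Relation.ReflTransGen (RewriteStep (CompressedRule R emb pre N k)) [blockSymbol start]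
        (w.map .terminal) ↔
      Relation.ReflTransGen (RewriteStep R) start.1 (pre ++ w.map emb) := by
  constructor
  · intro h
    rcases CompressedInvariant.of_reflTransGen h with ⟨c, rest, hz, -, -⟩ | ⟨-, h⟩
    · cases w with
      | nil => exact absurd rfl hw
      | cons t w => simp at hz
    · rwa [flatMap_decodeSymbol_terminals] at h
  · intro h
    obtain ⟨c, rest, hz, hd⟩ := compressedRule_reflTransGen (emb := emb) (pre := pre)
      (start := start) hR h
    cases w with
    | nil => exact absurd rfl hw
    | cons t w =>
      have hz' : (pre ++ [emb t]) ++ w.map emb = c.1 ++ rest := by simpa using hz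
      obtain ⟨hc, rfl⟩ := List.append_inj hz' (by simp [c.2, hk])
      refine hd.trans (.head ?_ (compressedRule_terminals [.terminal t] w))
      exact ⟨_, _, [], (w.map emb).map singleSymbol, .last hc.symm, rfl, rfl⟩

end Grammar

/-- A language is context-sensitive if it is generated by a finite length-nondecreasing rewriting
system that keeps a bounded number of additional symbols. -/
theorem Language.isContextSensitive_of_rewriteStep [Finite T] [Finite Γ]
    {R : List Γ → List Γ → Prop} {N : ℕ}
    (hR : ∀ l r, R l r → l ≠ [] ∧ l.length ≤ r.length ∧ r.length ≤ N)
    {emb : T → Γ} {pre start : List Γ}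
    (hs : start.length = pre.length + 1) {L : Language T}
    (hL : ∀ w, w ≠ [] →
      (w ∈ L ↔ Relation.ReflTransGen (RewriteStep R) start (pre ++ w.map emb))) :
    L.IsContextSensitive := by
  refine ⟨compressedGrammar R emb pre N (pre.length + 1) ⟨start, hs⟩, ?_⟩
  ext w
  change (w ≠ [] ∧ (compressedGrammar R emb pre N (pre.length + 1) ⟨start, hs⟩).Derives
    [blockSymbol ⟨start, hs⟩] (w.map .terminal)) ↔ (w ∈ L ∧ w ≠ [])
  refine and_comm.trans (and_congr_left fun hw =>
    (compressedGrammar_derives_iff.trans ?_).trans (hL w hw).symm)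
  exact compressedRule_terminals_iff hR rfl hw

end Rewriting

section OneHead

variable {Q S : Type}

/-- A word with exactly one head symbol: the symbols to the left of the head (nearest first), the
head, and the symbols to its right. -/
@[ext]
structure HeadConfig (Q S : Type) where
  /-- The symbols to the left of the head, from right to left. -/
  left : List S
  /-- The head. -/
  state : Q
  /-- The symbols to the right of the head. -/
  right : List S

namespace HeadConfig

/-- The word described by a configuration. -/
def word (c : HeadConfig Q S) : List (Q ⊕ S) :=
  c.left.reverse.map .inr ++ .inl c.state :: c.right.map .inr

/-- The configuration surrounded by further symbols. -/
def extend (c : HeadConfig Q S) (A B : List S) : HeadConfig Q S :=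
  ⟨c.left ++ A, c.state, c.right ++ B⟩

/-- One step of the machine with rules `R`. -/
def Step (R : HeadConfig Q S → HeadConfig Q S → Prop) (c d : HeadConfig Q S) : Prop :=
  ∃ x y A B, R x y ∧ c = x.extend A B ∧ d = y.extend A B

/-- The string rewriting rules of a machine. -/
def WordRule (R : HeadConfig Q S → HeadConfig Q S → Prop) (l r : List (Q ⊕ S)) : Prop :=
  ∃ x y, R x y ∧ l = x.word ∧ r = y.word

theorem word_extend (c : HeadConfig Q S) (A B : List S) :
    (c.extend A B).word = A.reverse.map .inr ++ c.word ++ B.map .inr := by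
  simp [word, extend]

theorem length_word (c : HeadConfig Q S) : c.word.length = c.left.length + c.right.length + 1 := by
  simp [word, Nat.add_assoc]

theorem eq_of_append_head {X Y : List (Q ⊕ S)} {A B : List S} {q q' : Q}
    (h : X ++ .inl q :: Y = A.map .inr ++ .inl q' :: B.map .inr) :
    X = A.map .inr ∧ q = q' ∧ Y = B.map .inr := by
  induction A generalizing X with
  | nil =>
    cases X with
    | nil => simpa using h
    | cons x X =>
      simp only [List.map_nil, List.nil_append, List.cons_append, List.cons.injEq] at h
      have : (Sum.inl q : Q ⊕ S) ∈ B.map .inr := by rw [← h.2]; simp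
      simp at this
  | cons a A ih =>
    cases X with
    | nil => simp at h
    | cons x X =>
      simp only [List.map_cons, List.cons_append, List.cons.injEq] at h
      obtain ⟨h1, h2, h3⟩ := ih h.2
      exact ⟨by rw [h.1, h1]; simp, h2, h3⟩

theorem word_injective : Function.Injective (word : HeadConfig Q S → List (Q ⊕ S)) := by
  intro c d h
  obtain ⟨h1, h2, h3⟩ := eq_of_append_head h
  have h1 := List.reverse_injective (List.map_injective_iff.2 Sum.inr_injective h1)
  have h3 := List.map_injective_iff.2 Sum.inr_injective h3
  exact HeadConfig.ext h1 h2 h3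

theorem rewriteStep_word_iff {R : HeadConfig Q S → HeadConfig Q S → Prop} {c : HeadConfig Q S}
    {z : List (Q ⊕ S)} :
    RewriteStep (WordRule R) c.word z ↔ ∃ d, Step R c d ∧ z = d.word := by
  constructor
  · rintro ⟨_, _, u, v, ⟨x, y, hxy, rfl, rfl⟩, hc, rfl⟩
    have h : (u ++ x.left.reverse.map .inr) ++ .inl x.state :: (x.right.map .inr ++ v) = c.word := by
      rw [hc]; simp [word]
    obtain ⟨h1, h2, h3⟩ := eq_of_append_head h
    obtain ⟨A, A', hA, rfl, hA'⟩ := List.map_eq_append_iff.1 h1.symm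
    obtain ⟨B', B, hB, hB', rfl⟩ := List.map_eq_append_iff.1 h3.symm
    obtain rfl := List.map_injective_iff.2 Sum.inr_injective hA'
    obtain rfl := List.map_injective_iff.2 Sum.inr_injective hB'
    refine ⟨y.extend A.reverse B, ⟨x, y, A.reverse, B, hxy, HeadConfig.ext ?_ h2.symm hB, rfl⟩, ?_⟩
    · rw [← List.reverse_reverse c.left, hA]; simp [extend]
    · rw [word_extend]; simp
  · rintro ⟨d, ⟨x, y, A, B, h, rfl, rfl⟩, rfl⟩
    exact ⟨_, _, _, _, ⟨x, y, h, rfl, rfl⟩, word_extend .., word_extend ..⟩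

theorem reflTransGen_word_iff {R : HeadConfig Q S → HeadConfig Q S → Prop} {c d : HeadConfig Q S} :
    Relation.ReflTransGen (RewriteStep (WordRule R)) c.word d.word ↔
      Relation.ReflTransGen (Step R) c d := by
  constructor
  · suffices ∀ z, Relation.ReflTransGen (RewriteStep (WordRule R)) c.word z →
        ∃ d, z = d.word ∧ Relation.ReflTransGen (Step R) c d by
      intro h
      obtain ⟨d', h1, h2⟩ := this _ h
      rwa [word_injective h1]
    intro z h
    induction h with
    | refl => exact ⟨c, rfl, .refl⟩
    | tail _ hs ih =>
      obtain ⟨d, rfl, hd⟩ := ih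
      obtain ⟨e, he, rfl⟩ := rewriteStep_word_iff.1 hs
      exact ⟨e, rfl, hd.tail he⟩
  · intro h
    exact h.lift word fun a b hab => rewriteStep_word_iff.2 ⟨b, hab, rfl⟩

end HeadConfig

end OneHead

section SubstitutionMachine

variable {T ι : Type}

/-- The words obtained from a one-letter word by the substitutions `σ i`, by rotations, and by
enclosing a word between `t` and `bar t`. -/
inductive SubstitutionClosure (σ : ι → T → List T) (bar : T → T) (t₀ : T) : List T → Prop
  | start : SubstitutionClosure σ bar t₀ [t₀]
  | subst (i : ι) {w : List T} : SubstitutionClosure σ bar t₀ w →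
      SubstitutionClosure σ bar t₀ (w.flatMap (σ i))
  | rotate {t : T} {w : List T} : SubstitutionClosure σ bar t₀ (t :: w) →
      SubstitutionClosure σ bar t₀ (w ++ [t])
  | conj (t : T) {w : List T} : SubstitutionClosure σ bar t₀ w →
      SubstitutionClosure σ bar t₀ (t :: (w ++ [bar t]))

/-- The heads of the machine that generates the words in `SubstitutionClosure`. -/
inductive SubstitutionHead (ι : Type)
  | idle
  | subst (i : ι)
  | rotate
  | back
  | check
  | finish

instance [Finite ι] : Finite (SubstitutionHead ι) :=
  Finite.of_surjective (fun x : ι ⊕ Fin 5 => x.elim SubstitutionHead.subst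
    ![.idle, .rotate, .back, .check, .finish]) (by
    rintro (_ | i | _ | _ | _ | _)
    exacts [⟨.inr 0, rfl⟩, ⟨.inl i, rfl⟩, ⟨.inr 1, rfl⟩, ⟨.inr 2, rfl⟩, ⟨.inr 3, rfl⟩,
      ⟨.inr 4, rfl⟩])

/-- The left end marker of the tape. -/
abbrev leftEnd : T ⊕ Bool := .inr false

/-- The right end marker of the tape. -/
abbrev rightEnd : T ⊕ Bool := .inr true

/-- The rules of the machine that generates the words in `SubstitutionClosure` in which
consecutive letters are related by `ok`. -/
inductive SubstitutionRule (σ : ι → T → List T) (bar : T → T) (ok : T → T → Prop) :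
    HeadConfig (SubstitutionHead ι) (T ⊕ Bool) → HeadConfig (SubstitutionHead ι) (T ⊕ Bool) → Prop
  | subst_start (i) : SubstitutionRule σ bar ok ⟨[], .idle, []⟩ ⟨[], .subst i, []⟩
  | subst_step (i t) : SubstitutionRule σ bar ok ⟨[], .subst i, [.inl t]⟩
      ⟨(σ i t).reverse.map .inl, .subst i, []⟩
  | subst_end (i) : SubstitutionRule σ bar ok ⟨[], .subst i, [rightEnd]⟩ ⟨[], .back, [rightEnd]⟩
  | back_step (t) : SubstitutionRule σ bar ok ⟨[.inl t], .back, []⟩ ⟨[], .back, [.inl t]⟩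
  | back_end : SubstitutionRule σ bar ok ⟨[leftEnd], .back, []⟩ ⟨[leftEnd], .idle, []⟩
  | rotate_start (t) : SubstitutionRule σ bar ok ⟨[], .idle, [.inl t]⟩ ⟨[], .rotate, [.inl t]⟩
  | conj_start (t) : SubstitutionRule σ bar ok ⟨[], .idle, []⟩
      ⟨[.inl t], .rotate, [.inl (bar t)]⟩
  | rotate_step (s t) : SubstitutionRule σ bar ok ⟨[], .rotate, [.inl s, .inl t]⟩
      ⟨[.inl t], .rotate, [.inl s]⟩
  | rotate_end (t) : SubstitutionRule σ bar ok ⟨[], .rotate, [.inl t, rightEnd]⟩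
      ⟨[], .back, [.inl t, rightEnd]⟩
  | check_start : SubstitutionRule σ bar ok ⟨[], .idle, []⟩ ⟨[], .check, []⟩
  | check_step {s t} : ok s t → SubstitutionRule σ bar ok ⟨[], .check, [.inl s, .inl t]⟩
      ⟨[.inl s], .check, [.inl t]⟩
  | check_end (t) : SubstitutionRule σ bar ok ⟨[], .check, [.inl t, rightEnd]⟩
      ⟨[], .finish, [rightEnd, .inl t]⟩
  | finish_step (t) : SubstitutionRule σ bar ok ⟨[.inl t], .finish, [rightEnd]⟩
      ⟨[], .finish, [rightEnd, .inl t]⟩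

variable {σ : ι → T → List T} {bar : T → T} {ok : T → T → Prop} {t₀ : T}

/-- The invariant of the runs of the machine. -/
def SubstitutionInvariant (σ : ι → T → List T) (bar : T → T) (ok : T → T → Prop) (t₀ : T)
    (c : HeadConfig (SubstitutionHead ι) (T ⊕ Bool)) : Prop :=
  match c.state with
  | .idle => ∃ w, SubstitutionClosure σ bar t₀ w ∧ c.left = [leftEnd] ∧
      c.right = w.map .inl ++ [rightEnd]
  | .subst i => ∃ u v : List T, SubstitutionClosure σ bar t₀ (u ++ v) ∧
      c.left = (u.flatMap (σ i)).reverse.map .inl ++ [leftEnd] ∧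
      c.right = v.map .inl ++ [rightEnd]
  | .back => ∃ u v : List T, SubstitutionClosure σ bar t₀ (u.reverse ++ v) ∧
      c.left = u.map .inl ++ [leftEnd] ∧ c.right = v.map .inl ++ [rightEnd]
  | .rotate => ∃ (u : List T) (t : T) (v : List T),
      SubstitutionClosure σ bar t₀ (u.reverse ++ v ++ [t]) ∧
      c.left = u.map .inl ++ [leftEnd] ∧ c.right = .inl t :: (v.map .inl ++ [rightEnd])
  | .check => ∃ u v : List T, SubstitutionClosure σ bar t₀ (u.reverse ++ v) ∧
      (u.reverse ++ v.take 1).IsChain ok ∧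
      c.left = u.map .inl ++ [leftEnd] ∧ c.right = v.map .inl ++ [rightEnd]
  | .finish => ∃ u v : List T, SubstitutionClosure σ bar t₀ (u.reverse ++ v) ∧
      (u.reverse ++ v).IsChain ok ∧
      c.left = u.map .inl ++ [leftEnd] ∧ c.right = rightEnd :: v.map .inl

theorem SubstitutionInvariant.step {c d : HeadConfig (SubstitutionHead ι) (T ⊕ Bool)}
    (hc : SubstitutionInvariant σ bar ok t₀ c)
    (h : HeadConfig.Step (SubstitutionRule σ bar ok) c d) :
    SubstitutionInvariant σ bar ok t₀ d := by
  obtain ⟨x, y, A, B, h, rfl, rfl⟩ := h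
  cases h with
  | subst_start i =>
    obtain ⟨w, hw, hA, hB⟩ := hc
    exact ⟨[], w, hw, hA, hB⟩
  | subst_step i t =>
    obtain ⟨u, v, hw, hA, hB⟩ := hc
    cases v with
    | nil => simp [HeadConfig.extend] at hB
    | cons s v =>
      simp [HeadConfig.extend] at hA hB
      obtain ⟨rfl, rfl⟩ := hB
      exact ⟨u ++ [t], v, by simpa using hw, by simp [HeadConfig.extend, hA], rfl⟩
  | subst_end i =>
    obtain ⟨u, v, hw, hA, hB⟩ := hc
    cases v with
    | nil => exact ⟨(u.flatMap (σ i)).reverse, [], by simpa using hw.subst i, hA, hB⟩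
    | cons s v => simp [HeadConfig.extend] at hB
  | back_step t =>
    obtain ⟨u, v, hw, hA, hB⟩ := hc
    cases u with
    | nil => simp [HeadConfig.extend] at hA
    | cons s u =>
      simp [HeadConfig.extend] at hA hB
      obtain ⟨rfl, rfl⟩ := hA
      exact ⟨u, t :: v, by simpa using hw, rfl, by simp [HeadConfig.extend, hB]⟩
  | back_end =>
    obtain ⟨u, v, hw, hA, hB⟩ := hc
    cases u with
    | nil => exact ⟨v, by simpa using hw, hA, hB⟩
    | cons s u => simp [HeadConfig.extend] at hA
  | rotate_start t =>
    obtain ⟨w, hw, hA, hB⟩ := hc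
    cases w with
    | nil => simp [HeadConfig.extend] at hB
    | cons s w => exact ⟨[], s, w, by simpa using hw.rotate, hA, hB⟩
  | conj_start t =>
    obtain ⟨w, hw, hA, hB⟩ := hc
    simp [HeadConfig.extend] at hA hB
    exact ⟨[t], bar t, w, by simpa using hw.conj t, by simp [HeadConfig.extend, hA],
      by simp [HeadConfig.extend, hB]⟩
  | rotate_step s t =>
    obtain ⟨u, r, v, hw, hA, hB⟩ := hc
    cases v with
    | nil => simp [HeadConfig.extend] at hB
    | cons q v =>
      simp [HeadConfig.extend] at hA hB
      obtain ⟨rfl, rfl, rfl⟩ := hB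
      exact ⟨t :: u, s, v, by simpa using hw, by simp [HeadConfig.extend, hA], rfl⟩
  | rotate_end t =>
    obtain ⟨u, r, v, hw, hA, hB⟩ := hc
    cases v with
    | nil => exact ⟨u, [r], by simpa using hw, hA, hB⟩
    | cons q v => simp [HeadConfig.extend] at hB
  | check_start =>
    obtain ⟨w, hw, hA, hB⟩ := hc
    refine ⟨[], w, hw, ?_, hA, hB⟩
    cases w <;> simp
  | @check_step s t hst =>
    obtain ⟨u, v, hw, hch, hA, hB⟩ := hc
    match v with
    | [] => simp [HeadConfig.extend] at hB
    | [r] => simp [HeadConfig.extend] at hB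
    | p :: q :: v =>
      simp [HeadConfig.extend] at hA hB
      obtain ⟨rfl, rfl, rfl⟩ := hB
      refine ⟨s :: u, t :: v, by simpa using hw, ?_, by simp [HeadConfig.extend, hA], rfl⟩
      have hch : (u.reverse ++ [s]).IsChain ok := hch
      rw [List.reverse_cons, List.isChain_append]
      exact ⟨hch, by simp, by simpa using hst⟩
  | check_end t =>
    obtain ⟨u, v, hw, hch, hA, hB⟩ := hc
    match v with
    | [] => simp [HeadConfig.extend] at hB
    | p :: q :: v => simp [HeadConfig.extend] at hB
    | [r] =>
      simp [HeadConfig.extend] at hA hB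
      obtain ⟨rfl, rfl⟩ := hB
      exact ⟨u, [t], hw, by simpa using hch, hA, rfl⟩
  | finish_step t =>
    obtain ⟨u, v, hw, hch, hA, hB⟩ := hc
    cases u with
    | nil => simp [HeadConfig.extend] at hA
    | cons s u =>
      simp [HeadConfig.extend] at hA hB
      obtain ⟨rfl, rfl⟩ := hA
      exact ⟨u, t :: v, by simpa using hw, by simpa using hch, rfl,
        by simp [HeadConfig.extend, hB]⟩

/-- The configuration of the machine in which the head stands between `u` and `v`. -/
def tapeConfig (q : SubstitutionHead ι) (u v : List T) :
    HeadConfig (SubstitutionHead ι) (T ⊕ Bool) :=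
  ⟨u.reverse.map .inl ++ [leftEnd], q, v.map .inl ++ [rightEnd]⟩

variable (σ bar ok) in
/-- The reachability relation of the machine. -/
abbrev SubstitutionReach :
    HeadConfig (SubstitutionHead ι) (T ⊕ Bool) → HeadConfig (SubstitutionHead ι) (T ⊕ Bool) → Prop :=
  Relation.ReflTransGen (HeadConfig.Step (SubstitutionRule σ bar ok))

theorem substitutionReach_back (u v : List T) :
    SubstitutionReach σ bar ok (tapeConfig .back u v) (tapeConfig .idle [] (u ++ v)) := by
  induction u using List.reverseRecOn generalizing v with
  | nil => exact .single ⟨_, _, [], _, .back_end, by simp [HeadConfig.extend, tapeConfig]; rfl,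
      by simp [HeadConfig.extend, tapeConfig]⟩
  | append_singleton u t ih =>
    refine .head ⟨_, _, u.reverse.map .inl ++ [leftEnd], v.map .inl ++ [rightEnd], .back_step t,
      ?_, ?_⟩ (by simpa using ih (t :: v)) <;> simp [HeadConfig.extend, tapeConfig]

theorem substitutionReach_subst (i : ι) (u v : List T) :
    SubstitutionReach σ bar ok (tapeConfig (.subst i) u v)
      (tapeConfig .idle [] (u ++ v.flatMap (σ i))) := by
  induction v generalizing u with
  | nil =>
    refine .head ⟨_, _, u.reverse.map .inl ++ [leftEnd], [], .subst_end i, ?_, ?_⟩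
      (by simpa using substitutionReach_back u []) <;> simp [HeadConfig.extend, tapeConfig]
  | cons t v ih =>
    refine .head ⟨_, _, u.reverse.map .inl ++ [leftEnd], v.map .inl ++ [rightEnd],
      .subst_step i t, ?_, ?_⟩ (by simpa using ih (u ++ σ i t)) <;>
      simp [HeadConfig.extend, tapeConfig]

theorem substitutionReach_rotate (t : T) (u v : List T) :
    SubstitutionReach σ bar ok (tapeConfig .rotate u (t :: v))
      (tapeConfig .idle [] (u ++ v ++ [t])) := by
  induction v generalizing u with
  | nil =>
    refine .head ⟨_, _, u.reverse.map .inl ++ [leftEnd], [], .rotate_end t, ?_, ?_⟩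
      (by simpa using substitutionReach_back u [t]) <;> simp [HeadConfig.extend, tapeConfig]
  | cons s v ih =>
    refine .head ⟨_, _, u.reverse.map .inl ++ [leftEnd], v.map .inl ++ [rightEnd],
      .rotate_step t s, ?_, ?_⟩ (by simpa using ih (u ++ [s])) <;>
      simp [HeadConfig.extend, tapeConfig]

theorem substitutionReach_finish (u v : List T) :
    SubstitutionReach σ bar ok ⟨u.reverse.map .inl ++ [leftEnd], .finish, rightEnd :: v.map .inl⟩
      ⟨[leftEnd], .finish, rightEnd :: (u ++ v).map .inl⟩ := by
  induction u using List.reverseRecOn generalizing v with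
  | nil => exact .refl
  | append_singleton u t ih =>
    refine .head ⟨_, _, u.reverse.map .inl ++ [leftEnd], v.map .inl, .finish_step t,
      ?_, ?_⟩ (by simpa using ih (t :: v)) <;> simp [HeadConfig.extend]

theorem substitutionReach_check (t : T) (u v : List T) (h : (t :: v).IsChain ok) :
    SubstitutionReach σ bar ok (tapeConfig .check u (t :: v))
      ⟨[leftEnd], .finish, rightEnd :: (u ++ t :: v).map .inl⟩ := by
  induction v generalizing u t with
  | nil =>
    refine .head ⟨_, _, u.reverse.map .inl ++ [leftEnd], [], .check_end t, ?_, ?_⟩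
      (by simpa using substitutionReach_finish u [t]) <;> simp [HeadConfig.extend, tapeConfig]
  | cons s v ih =>
    rw [List.isChain_cons_cons] at h
    refine .head ⟨_, _, u.reverse.map .inl ++ [leftEnd], v.map .inl ++ [rightEnd],
      .check_step h.1, ?_, ?_⟩ (by simpa using ih s (u ++ [t]) h.2) <;>
      simp [HeadConfig.extend, tapeConfig]

theorem SubstitutionClosure.reach {w : List T} (h : SubstitutionClosure σ bar t₀ w) :
    SubstitutionReach σ bar ok (tapeConfig .idle [] [t₀]) (tapeConfig .idle [] w) := by
  induction h with
  | start => exact .refl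
  | @subst i w _ ih =>
    refine ih.trans (.head ⟨_, _, [leftEnd], w.map .inl ++ [rightEnd], .subst_start i, ?_, ?_⟩
      (substitutionReach_subst i [] w)) <;> simp [HeadConfig.extend, tapeConfig]
  | @rotate t w _ ih =>
    refine ih.trans (.head ⟨_, _, [leftEnd], w.map .inl ++ [rightEnd], .rotate_start t, ?_, ?_⟩
      (substitutionReach_rotate t [] w)) <;> simp [HeadConfig.extend, tapeConfig]
  | @conj t w _ ih =>
    refine ih.trans (.head ⟨_, _, [leftEnd], w.map .inl ++ [rightEnd], .conj_start t, ?_, ?_⟩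
      (substitutionReach_rotate (bar t) [t] w)) <;> simp [HeadConfig.extend, tapeConfig]

theorem SubstitutionRule.length_le (hσ : ∀ i t, σ i t ≠ [] ∧ (σ i t).length ≤ 3)
    {c d : HeadConfig (SubstitutionHead ι) (T ⊕ Bool)} (h : SubstitutionRule σ bar ok c d) :
    c.word.length ≤ d.word.length ∧ d.word.length ≤ 4 := by
  cases h with
  | subst_step i t =>
    have h1 := List.length_pos_iff.2 (hσ i t).1
    have h2 := (hσ i t).2
    simp [HeadConfig.length_word]
    omega
  | _ => simp [HeadConfig.length_word]

/-- The words in `SubstitutionClosure` in which consecutive letters are related by `ok` form a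
context-sensitive language. -/
theorem SubstitutionClosure.isContextSensitive [Finite T] [Finite ι]
    (hσ : ∀ i t, σ i t ≠ [] ∧ (σ i t).length ≤ 3) :
    Language.IsContextSensitive {w : List T | SubstitutionClosure σ bar t₀ w ∧ w.IsChain ok} := by
  refine Language.isContextSensitive_of_rewriteStep (N := 4)
    (R := HeadConfig.WordRule (SubstitutionRule σ bar ok)) (emb := fun t => .inr (.inl t))
    (pre := [.inr leftEnd, .inl .finish, .inr rightEnd])
    (start := (tapeConfig .idle [] [t₀]).word) ?_ (by simp [tapeConfig, HeadConfig.word]) ?_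
  · rintro _ _ ⟨x, y, h, rfl, rfl⟩
    refine ⟨?_, h.length_le hσ⟩
    simp [HeadConfig.word]
  · intro w hw
    have : [.inr leftEnd, .inl .finish, .inr rightEnd] ++ w.map (fun t => .inr (.inl t)) =
        HeadConfig.word (⟨[leftEnd], .finish, rightEnd :: w.map .inl⟩ :
          HeadConfig (SubstitutionHead ι) (T ⊕ Bool)) := by
      simp [HeadConfig.word]
    rw [this, HeadConfig.reflTransGen_word_iff]
    constructor
    · rintro ⟨h, hch⟩
      cases w with
      | nil => exact absurd rfl hw
      | cons t w =>
        refine h.reach.trans (.head ⟨_, _, [leftEnd], (t :: w).map .inl ++ [rightEnd],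
          .check_start, ?_, ?_⟩ (substitutionReach_check t [] w hch)) <;>
          simp [HeadConfig.extend, tapeConfig]
    · intro h
      suffices ∀ d, SubstitutionReach σ bar ok (tapeConfig .idle [] [t₀]) d →
          SubstitutionInvariant σ bar ok t₀ d by
        obtain ⟨u, v, h1, h2, h3, h4⟩ := this _ h
        cases u with
        | nil =>
          simp at h4
          obtain rfl := List.map_injective_iff.2 Sum.inl_injective h4
          exact ⟨h1, h2⟩
        | cons s u => simp at h3
      intro d hd
      induction hd with
      | refl => exact ⟨[t₀], .start, rfl, rfl⟩
      | tail _ hs ih => exact ih.step hs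

end SubstitutionMachine

section Automorphisms

open FreeGroup

/-- The endomorphism of the free group of rank two with given images of the two generators. -/
def pairHom (x y : FreeGroup (Fin 2)) : FreeGroup (Fin 2) →* FreeGroup (Fin 2) :=
  FreeGroup.lift ![x, y]

@[simp]
theorem pairHom_of_zero (x y : FreeGroup (Fin 2)) : pairHom x y (of 0) = x := by simp [pairHom]

@[simp]
theorem pairHom_of_one (x y : FreeGroup (Fin 2)) : pairHom x y (of 1) = y := by simp [pairHom]

theorem hom_ext_pair {f g : FreeGroup (Fin 2) →* FreeGroup (Fin 2)}
    (h₀ : f (of 0) = g (of 0)) (h₁ : f (of 1) = g (of 1)) : f = g :=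
  FreeGroup.ext_hom _ _ fun i => by fin_cases i <;> assumption

/-- The automorphism `a ↦ ab`, `b ↦ b`. -/
def transvection : MulAut (FreeGroup (Fin 2)) :=
  MonoidHom.toMulEquiv (pairHom (of 0 * of 1) (of 1)) (pairHom (of 0 * (of 1)⁻¹) (of 1))
    (hom_ext_pair (by simp) (by simp)) (hom_ext_pair (by simp) (by simp))

@[simp]
theorem transvection_of_zero : transvection (of 0) = of 0 * of 1 := by
  simp [transvection]

@[simp]
theorem transvection_of_one : transvection (of 1) = of 1 :=
  pairHom_of_one (of 0 * of 1) (of 1)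

@[simp]
theorem transvection_symm_of_zero :
    MulEquiv.symm transvection (of 0) = of 0 * (of 1)⁻¹ := by
  simp [transvection]

@[simp]
theorem transvection_symm_of_one : MulEquiv.symm transvection (of 1) = of 1 :=
  pairHom_of_one (of 0 * (of 1)⁻¹) (of 1)

/-- The automorphism that exchanges the two generators. -/
def swapAut : MulAut (FreeGroup (Fin 2)) :=
  MonoidHom.toMulEquiv (pairHom (of 1) (of 0)) (pairHom (of 1) (of 0))
    (hom_ext_pair (by simp) (by simp)) (hom_ext_pair (by simp) (by simp))

@[simp]
theorem swapAut_of_zero : swapAut (of 0) = of 1 := pairHom_of_zero (of 1) (of 0)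

@[simp]
theorem swapAut_of_one : swapAut (of 1) = of 0 := pairHom_of_one (of 1) (of 0)

@[simp]
theorem swapAut_swapAut (x : FreeGroup (Fin 2)) : swapAut (swapAut x) = x :=
  swapAut.symm_apply_apply x

theorem mk_singleton_eq_cond {α : Type*} (i : α) (b : Bool) :
    FreeGroup.mk [(i, b)] = cond b (of i) (of i)⁻¹ := by
  cases b <;> simp [of, FreeGroup.inv_mk, FreeGroup.invRev]

/-- The endomorphism that inverts the generators `i` with `e i = false`. -/
def letterSignHom (e : Fin 2 → Bool) : FreeGroup (Fin 2) →* FreeGroup (Fin 2) :=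
  FreeGroup.lift fun i => cond (e i) (of i) (of i)⁻¹

@[simp]
theorem letterSignHom_of (e : Fin 2 → Bool) (i : Fin 2) :
    letterSignHom e (of i) = cond (e i) (of i) (of i)⁻¹ := by
  simp [letterSignHom]

theorem letterSignHom_letterSignHom (e e' : Fin 2 → Bool) (x : FreeGroup (Fin 2)) :
    letterSignHom e (letterSignHom e' x) = letterSignHom (fun i => e i == e' i) x := by
  refine DFunLike.congr_fun (f := (letterSignHom e).comp (letterSignHom e')) ?_ x
  refine FreeGroup.ext_hom _ _ fun i => ?_
  cases h : e' i <;> cases h' : e i <;> simp [h, h']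

theorem letterSignHom_true (x : FreeGroup (Fin 2)) : letterSignHom (fun _ => true) x = x := by
  refine DFunLike.congr_fun (g := MonoidHom.id _) ?_ x
  exact FreeGroup.ext_hom _ _ fun i => by simp

/-- The automorphism that inverts the generators `i` with `e i = false`. -/
def signAut (e : Fin 2 → Bool) : MulAut (FreeGroup (Fin 2)) :=
  MonoidHom.toMulEquiv (letterSignHom e) (letterSignHom e)
    (by ext1; simp [-letterSignHom_of, letterSignHom_letterSignHom, letterSignHom_true])
    (by ext1; simp [-letterSignHom_of, letterSignHom_letterSignHom, letterSignHom_true])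

@[simp]
theorem signAut_apply (e : Fin 2 → Bool) (x : FreeGroup (Fin 2)) :
    signAut e x = letterSignHom e x := rfl

theorem swapAut_letterSignHom (e : Fin 2 → Bool) (x : FreeGroup (Fin 2)) :
    swapAut (letterSignHom e x) = letterSignHom ![e 1, e 0] (swapAut x) := by
  refine DFunLike.congr_fun (f := swapAut.toMonoidHom.comp (letterSignHom e))
    (g := (letterSignHom _).comp swapAut.toMonoidHom) ?_ x
  refine hom_ext_pair ?_ ?_
  · cases h : e 0
    · simp [h]
    · simp [h]
  · cases h : e 1
    · simp [h]
    · simp [h]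

/-- The images of the first generator under the products of `transvection` and `swapAut`. -/
inductive IsPositivePrimitive : FreeGroup (Fin 2) → Prop
  | of_zero : IsPositivePrimitive (of 0)
  | transvection {x} : IsPositivePrimitive x → IsPositivePrimitive (transvection x)
  | swap {x} : IsPositivePrimitive x → IsPositivePrimitive (swapAut x)

/-- The elements that are conjugate to a positive primitive element up to the signs of the
generators. -/
def IsSignedPrimitive (x : FreeGroup (Fin 2)) : Prop :=
  ∃ g e y, IsPositivePrimitive y ∧ x = g * letterSignHom e y * g⁻¹

namespace IsSignedPrimitive

theorem of_positive {x : FreeGroup (Fin 2)} (h : IsPositivePrimitive x) : IsSignedPrimitive x :=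
  ⟨1, fun _ => true, x, h, by simp [letterSignHom_true]⟩

theorem conj {x : FreeGroup (Fin 2)} (h : IsSignedPrimitive x) (g : FreeGroup (Fin 2)) :
    IsSignedPrimitive (g * x * g⁻¹) := by
  obtain ⟨g', e, y, hy, rfl⟩ := h
  exact ⟨g * g', e, y, hy, by group⟩

theorem sign {x : FreeGroup (Fin 2)} (h : IsSignedPrimitive x) (e : Fin 2 → Bool) :
    IsSignedPrimitive (letterSignHom e x) := by
  obtain ⟨g, e', y, hy, rfl⟩ := h
  exact ⟨letterSignHom e g, fun i => e i == e' i, y, hy, by simp [letterSignHom_letterSignHom]⟩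

theorem swap {x : FreeGroup (Fin 2)} (h : IsSignedPrimitive x) :
    IsSignedPrimitive (swapAut x) := by
  obtain ⟨g, e, y, hy, rfl⟩ := h
  exact ⟨swapAut g, ![e 1, e 0], _, hy.swap, by simp [swapAut_letterSignHom]⟩

theorem transvection_inv_swap_transvection (x : FreeGroup (Fin 2)) :
    transvection⁻¹ (swapAut (transvection x)) =
      of 1 * letterSignHom ![true, false] (swapAut (transvection (swapAut x))) * (of 1)⁻¹ := by
  refine DFunLike.congr_fun
    (f := (transvection⁻¹ * swapAut * transvection : MulAut _).toMonoidHom)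
    (g := (MulAut.conj (of 1) * signAut ![true, false] * swapAut * transvection * swapAut :
      MulAut _).toMonoidHom) ?_ x
  refine hom_ext_pair ?_ ?_
  · simp [mul_assoc]
  · simp [mul_assoc]

theorem transvection_inv_positive {x : FreeGroup (Fin 2)} (h : IsPositivePrimitive x) :
    IsSignedPrimitive (transvection⁻¹ x) ∧ IsSignedPrimitive (transvection⁻¹ (swapAut x)) := by
  induction h with
  | of_zero =>
    constructor
    · refine ⟨1, ![true, false], _, .transvection .of_zero, ?_⟩
      simp
    · simpa using of_positive (.swap .of_zero)
  | @transvection y hy ih =>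
    refine ⟨by simpa using of_positive hy, ?_⟩
    rw [transvection_inv_swap_transvection]
    exact ((of_positive hy.swap.transvection.swap).sign _).conj _
  | swap _ ih => exact ⟨ih.2, by simpa using ih.1⟩

theorem transvection_sign (e : Fin 2 → Bool) :
    ∃ g, (∀ x, transvection (letterSignHom e x) = letterSignHom e (g * transvection x * g⁻¹)) ∨
      ∀ x, transvection (letterSignHom e x) = letterSignHom e (g * transvection⁻¹ x * g⁻¹) := by
  suffices ∃ g, (transvection * signAut e = signAut e * MulAut.conj g * transvection ∨
      transvection * signAut e = signAut e * MulAut.conj g * transvection⁻¹) by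
    obtain ⟨g, h⟩ := this
    exact ⟨g, h.imp (fun h x => DFunLike.congr_fun h x) (fun h x => DFunLike.congr_fun h x)⟩
  have key {f g : MulAut (FreeGroup (Fin 2))} (h0 : f (of 0) = g (of 0))
      (h1 : f (of 1) = g (of 1)) : f = g :=
    MulEquiv.toMonoidHom_injective (hom_ext_pair h0 h1)
  cases h0 : e 0 <;> cases h1 : e 1
  · refine ⟨of 1, .inl (key ?_ ?_)⟩ <;>
      simp [h0, h1, mul_assoc]
  · refine ⟨(of 1)⁻¹, .inr (key ?_ ?_)⟩ <;>
      simp [h0, h1, mul_assoc]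
  · refine ⟨1, .inr (key ?_ ?_)⟩ <;>
      simp [h0, h1]
  · refine ⟨1, .inl (key ?_ ?_)⟩ <;>
      simp [h0, h1]

protected theorem transvection {x : FreeGroup (Fin 2)} (h : IsSignedPrimitive x) :
    IsSignedPrimitive (transvection x) := by
  obtain ⟨g, e, y, hy, rfl⟩ := h
  rw [_root_.map_mul, _root_.map_mul, _root_.map_inv]
  obtain ⟨k, h | h⟩ := transvection_sign e
  · rw [h]
    exact (((of_positive hy.transvection).conj _).sign _).conj _
  · rw [h]
    exact (((transvection_inv_positive hy).1.conj _).sign _).conj _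

theorem transvection_inv {x : FreeGroup (Fin 2)} (h : IsSignedPrimitive x) :
    IsSignedPrimitive (transvection⁻¹ x) := by
  have : transvection⁻¹ x =
      letterSignHom ![true, false] (transvection (letterSignHom ![true, false] x)) := by
    refine DFunLike.congr_fun (f := (transvection⁻¹ : MulAut _).toMonoidHom)
      (g := (signAut ![true, false] * transvection * signAut ![true, false] :
        MulAut _).toMonoidHom) ?_ x
    refine hom_ext_pair ?_ ?_ <;> simp
  rw [this]
  exact (h.sign _).transvection.sign _

end IsSignedPrimitive

/-- The automorphisms that preserve `IsSignedPrimitive`. -/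
def signedPrimitiveStabilizer : Subgroup (MulAut (FreeGroup (Fin 2))) where
  carrier := {f | ∀ x, IsSignedPrimitive (f x) ↔ IsSignedPrimitive x}
  one_mem' _ := Iff.rfl
  mul_mem' hf hg x := (hf _).trans (hg x)
  inv_mem' {f} hf x := by
    rw [← hf (f⁻¹ x), MulAut.apply_inv_self]

theorem transvection_mem_stabilizer : transvection ∈ signedPrimitiveStabilizer := fun x =>
  ⟨fun h => by simpa using h.transvection_inv, fun h => h.transvection⟩

theorem swapAut_mem_stabilizer : swapAut ∈ signedPrimitiveStabilizer := fun x =>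
  ⟨fun h => by simpa using h.swap, fun h => h.swap⟩

theorem signAut_mem_stabilizer (e : Fin 2 → Bool) : signAut e ∈ signedPrimitiveStabilizer :=
  fun x => ⟨fun h => by simpa [letterSignHom_letterSignHom, letterSignHom_true] using h.sign e,
    fun h => h.sign e⟩

theorem conj_mem_stabilizer (g : FreeGroup (Fin 2)) :
    MulAut.conj g ∈ signedPrimitiveStabilizer := fun x =>
  ⟨fun h => by simpa [mul_assoc] using h.conj g⁻¹, fun h => h.conj g⟩

end Automorphisms

section CommonPrefix

variable {α : Type*}

/-- The length of the longest common prefix of two lists. -/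
def commonPrefixLength [DecidableEq α] : List α → List α → ℕ
  | a :: u, b :: v => if a = b then commonPrefixLength u v + 1 else 0
  | _, _ => 0

theorem le_commonPrefixLength_iff [DecidableEq α] {u v : List α} {n : ℕ} :
    n ≤ commonPrefixLength u v ↔ ∃ p : List α, p.length = n ∧ p <+: u ∧ p <+: v := by
  induction u generalizing v n with
  | nil => simp [commonPrefixLength, eq_comm]
  | cons a u ih =>
    cases v with
    | nil => simp [commonPrefixLength, eq_comm]
    | cons b v =>
      cases n with
      | zero => simp
      | succ n =>
        rw [commonPrefixLength]
        constructor
        · intro h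
          split_ifs at h with hab
          · obtain ⟨p, h1, h2, h3⟩ := ih.1 (Nat.le_of_succ_le_succ h)
            exact ⟨a :: p, by simp [h1], by simpa using h2, by simp [hab, h3]⟩
          · omega
        · rintro ⟨p, h1, h2, h3⟩
          cases p with
          | nil => simp at h1
          | cons c p =>
            rw [List.cons_prefix_cons] at h2 h3
            rw [if_pos (h2.1.symm.trans h3.1)]
            exact Nat.succ_le_succ (ih.2 ⟨p, by simpa using h1, h2.2, h3.2⟩)

theorem commonPrefixLength_comm [DecidableEq α] (u v : List α) :
    commonPrefixLength u v = commonPrefixLength v u := by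
  refine eq_of_forall_le_iff fun n => ?_
  rw [le_commonPrefixLength_iff, le_commonPrefixLength_iff]
  simp only [and_comm]

theorem min_commonPrefixLength_le [DecidableEq α] (u v w : List α) :
    min (commonPrefixLength u v) (commonPrefixLength v w) ≤ commonPrefixLength u w := by
  obtain ⟨p, hp, hpu, hpv⟩ := le_commonPrefixLength_iff.1
    (min_le_left (commonPrefixLength u v) (commonPrefixLength v w))
  obtain ⟨q, hq, hqv, hqw⟩ := le_commonPrefixLength_iff.1
    (min_le_right (commonPrefixLength u v) (commonPrefixLength v w))
  obtain rfl : p = q :=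
    (List.prefix_of_prefix_length_le hpv hqv (by omega)).eq_of_length (by omega)
  exact le_commonPrefixLength_iff.2 ⟨p, hp, hpu, hqw⟩

end CommonPrefix

namespace FreeGroup

variable {α : Type*} [DecidableEq α]

/-- The number of letters that cancel in `x⁻¹ * y`. -/
def cancellation (x y : FreeGroup α) : ℕ := commonPrefixLength x.toWord y.toWord

theorem cancellation_comm (x y : FreeGroup α) : cancellation x y = cancellation y x :=
  commonPrefixLength_comm _ _

theorem min_cancellation_le (x y z : FreeGroup α) :
    min (cancellation x y) (cancellation y z) ≤ cancellation x z :=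
  min_commonPrefixLength_le _ _ _

theorem norm_inv_mul_add_cancellation (x y : FreeGroup α) :
    norm (x⁻¹ * y) + 2 * cancellation x y = norm x + norm y := by
  have key : ∀ u v : List (α × Bool), IsReduced u → IsReduced v →
      norm ((mk u)⁻¹ * mk v) + 2 * commonPrefixLength u v = u.length + v.length := by
    intro u
    induction u with
    | nil =>
      intro v _ hv
      simp [commonPrefixLength, norm, ← one_eq_mk, hv.reduce_eq]
    | cons a u ih =>
      intro v hu hv
      cases v with
      | nil =>
        simp only [commonPrefixLength, ← one_eq_mk, mul_one, norm_inv_eq]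
        simp [norm, hu.reduce_eq]
      | cons b v =>
        rw [commonPrefixLength]
        split_ifs with hab
        · subst hab
          have := ih v (hu.infix (List.suffix_cons _ _).isInfix)
            (hv.infix (List.suffix_cons _ _).isInfix)
          have h : (mk (a :: u))⁻¹ * mk (a :: v) = (mk u)⁻¹ * mk v := by
            rw [← List.singleton_append, ← List.singleton_append (l := v), ← mul_mk, ← mul_mk]
            group
          rw [h]
          simp only [List.length_cons]
          omega
        · have hr : IsReduced (invRev (a :: u) ++ b :: v) := by
            have hinv : IsReduced (invRev (a :: u)) := by
              rw [isReduced_iff_reduce_eq, reduce_invRev, hu.reduce_eq]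
            refine List.isChain_append.2 ⟨hinv, hv, ?_⟩
            intro x hx y hy
            simp only [invRev, List.map_cons, List.reverse_cons, List.getLast?_append,
              List.getLast?_singleton, Option.some_or, Option.mem_def, Option.some.injEq,
              List.head?_cons] at hx hy
            subst hx hy
            intro h1
            by_contra h2
            exact hab (Prod.ext h1 (by simpa using h2))
          rw [inv_mk, mul_mk, norm, toWord_mk, hr.reduce_eq]
          simp
  have := key _ _ (isReduced_toWord (x := x)) (isReduced_toWord (x := y))
  simpa only [mk_toWord, ← cancellation.eq_def, ← norm.eq_def] using this

@[simp]
theorem cancellation_self (x : FreeGroup α) : cancellation x x = norm x := by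
  have := norm_inv_mul_add_cancellation x x
  simp at this
  omega

theorem norm_lt_norm_sq {x : FreeGroup α} (hx : x ≠ 1) : norm x < norm (x * x) := by
  have hred := isReduced_toWord (x := x)
  have h1 := reduceCyclically.conj_conjugator_reduceCyclically x.toWord
  have h2 := reduceCyclically.reduce_flatten_replicate_succ hred 1
  have h3 := congrArg List.length h1
  have h4 : norm (x * x) = _ := congrArg List.length ((toWord_mul x x).trans
    (by simpa [List.replicate_succ] using h2))
  have h5 : reduceCyclically x.toWord ≠ [] := by
    intro h
    rw [h, List.append_nil] at h1
    refine hx ?_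
    rw [← mk_toWord (x := x), ← h1, ← mul_mk, ← inv_mk, mul_inv_cancel]
  have h6 := List.length_pos_iff.2 h5
  rw [h4]
  simp only [List.length_append, invRev_length] at h3 ⊢
  simp only [norm]
  omega

theorem two_mul_cancellation_inv_lt {x : FreeGroup α} (hx : x ≠ 1) :
    2 * cancellation x x⁻¹ < norm x := by
  have h1 := norm_inv_mul_add_cancellation x x⁻¹
  have h2 := norm_lt_norm_sq (inv_ne_one.2 hx)
  rw [norm_inv_eq] at h1 h2
  omega

/-- If the first half of `y` is a prefix of `x` and the second half is a suffix, then a conjugate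
of the pair `(x * y⁻¹, y)` is shorter than `(x, y)`. -/
theorem exists_conj_norm_lt {x y : FreeGroup α} (hy : y ≠ 1)
    (h₁ : 2 * cancellation y x = norm y) (h₂ : 2 * cancellation y⁻¹ x⁻¹ = norm y)
    (hx : norm y ≤ norm x) :
    ∃ p, norm (p * (x * y⁻¹) * p⁻¹) + norm (p * y * p⁻¹) < norm x + norm y := by
  obtain ⟨p, hp, ⟨r, hr⟩, hpx⟩ := le_commonPrefixLength_iff.1 (le_refl (cancellation y x))
  obtain ⟨q, hq, hqy, ⟨s, hs⟩⟩ := le_commonPrefixLength_iff.1 (le_refl (cancellation y⁻¹ x⁻¹))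
  have hn : norm y = p.length + r.length := by rw [norm, ← hr, List.length_append]
  have hqr : q = invRev r := by
    refine (List.prefix_of_prefix_length_le hqy ?_ ?_).eq_of_length ?_
    · rw [toWord_inv, ← hr, invRev_append]; exact List.prefix_append _ _
    · rw [invRev_length]; omega
    · rw [invRev_length]; omega
  have hxw : x.toWord = invRev s ++ r := by
    rw [← inv_inv x, toWord_inv, ← hs, invRev_append, hqr, invRev_invRev]
  have hnx : norm x = s.length + r.length := by
    rw [norm, hxw, List.length_append, invRev_length]
  obtain ⟨m, hm⟩ : p <+: invRev s :=
    List.prefix_of_prefix_length_le (l₃ := x.toWord) hpx (by rw [hxw]; exact List.prefix_append _ _)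
      (by rw [invRev_length]; omega)
  have hms := congrArg List.length hm
  rw [List.length_append, invRev_length] at hms
  have hy' : y = mk p * mk r := by rw [mul_mk, hr, mk_toWord]
  have hx' : x = mk p * mk m * mk r := by rw [mul_mk, mul_mk, hm, ← hxw, mk_toWord]
  refine ⟨(mk p)⁻¹, ?_⟩
  have e1 : (mk p)⁻¹ * (x * y⁻¹) * (mk p)⁻¹⁻¹ = mk m := by rw [hx', hy']; group
  have e2 : (mk p)⁻¹ * y * (mk p)⁻¹⁻¹ = mk (r ++ p) := by rw [hy', ← mul_mk]; group
  have b1 := norm_mk_le (L₁ := m)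
  have b2 := norm_mk_le (L₁ := r ++ p)
  have b3 : 0 < norm y := Nat.pos_of_ne_zero (norm_eq_zero.not.2 hy)
  rw [List.length_append] at b2
  rw [e1, e2]
  omega

/-- If the cancellations at the two ends of the images of the letters do not meet, then a
homomorphism does not decrease the length. -/
theorem length_le_norm_of_cancellation {β : Type*} (f : FreeGroup β →* FreeGroup α)
    (hf : ∀ l k k' : β × Bool, k ≠ l → k' ≠ (l.1, !l.2) →
      cancellation (f (mk [l])) (f (mk [k])) + cancellation (f (mk [l]))⁻¹ (f (mk [k'])) <
        norm (f (mk [l])))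
    {w : List (β × Bool)} (hw : IsReduced w) : w.length ≤ norm (f (mk w)) := by
  have hbar (l : β × Bool) : f (mk [(l.1, !l.2)]) = (f (mk [l]))⁻¹ := by
    rw [← _root_.map_inv]; simp [inv_mk, invRev]
  have key : ∀ w l, IsReduced (w ++ [l]) → ∃ k, k ≠ l ∧
      norm (f (mk [l])) ≤ cancellation (f (mk (w ++ [l])))⁻¹ (f (mk [l]))⁻¹ +
        cancellation (f (mk [l])) (f (mk [k])) ∧
      w.length + norm (f (mk [l])) ≤ norm (f (mk (w ++ [l]))) +
        cancellation (f (mk [l])) (f (mk [k])) := by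
    intro w
    induction w using List.reverseRecOn with
    | nil =>
      intro l _
      refine ⟨(l.1, !l.2), by simp [Prod.ext_iff], ?_, ?_⟩ <;> simp [norm_inv_eq]
    | append_singleton w l ih =>
      intro m hr
      have hlm : m ≠ (l.1, !l.2) := by
        rintro rfl
        have := hr.infix (L₁ := [l, (l.1, !l.2)]) ⟨w, [], by simp⟩
        simp at this
      obtain ⟨k, hk, h1, h2⟩ := ih l (hr.infix (List.prefix_append _ _).isInfix)
      have h3 := hf l k m hk hlm
      refine ⟨(l.1, !l.2), hlm.symm, ?_⟩
      rw [← mul_mk, _root_.map_mul, hbar]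
      set g := f (mk (w ++ [l]))
      set x := f (mk [l])
      set y := f (mk [m])
      have c1 := min_cancellation_le g⁻¹ x⁻¹ y
      have c2 := min_cancellation_le x⁻¹ g⁻¹ y
      rw [cancellation_comm x⁻¹ g⁻¹] at c2
      have c3 : cancellation g⁻¹ y = cancellation x⁻¹ y := by omega
      have n1 := norm_inv_mul_add_cancellation g⁻¹ y
      have n2 := norm_inv_mul_add_cancellation (g * y)⁻¹ y⁻¹
      rw [inv_inv, norm_inv_eq] at n1
      rw [inv_inv, norm_inv_eq, norm_inv_eq, mul_inv_cancel_right] at n2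
      rw [cancellation_comm y x⁻¹]
      simp only [List.length_append, List.length_singleton]
      omega
  rcases List.eq_nil_or_concat w with rfl | ⟨w, l, rfl⟩
  · simp
  · rw [List.concat_eq_append] at hw ⊢
    obtain ⟨k, hk, _, h⟩ := key w l hw
    have := hf l k l hk (by simp [Prod.ext_iff])
    simp only [List.length_append, List.length_singleton]
    omega

end FreeGroup

section Nielsen

open FreeGroup

/-- The total length of the images of the generators. -/
def imageNorm (f : MulAut (FreeGroup (Fin 2))) : ℕ := norm (f (of 0)) + norm (f (of 1))

theorem norm_apply_mk_singleton {G : Type*} [FunLike G (FreeGroup (Fin 2)) (FreeGroup (Fin 2))]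
    [MonoidHomClass G (FreeGroup (Fin 2)) (FreeGroup (Fin 2))] (f : G) (l : Fin 2 × Bool) :
    norm (f (mk [l])) = norm (f (of l.1)) := by
  obtain ⟨i, _ | _⟩ := l
  · rw [mk_singleton_eq_cond, cond_false, _root_.map_inv, norm_inv_eq]
  · rfl

theorem imageNorm_eq (f : MulAut (FreeGroup (Fin 2))) {l k : Fin 2 × Bool} (h : l.1 ≠ k.1) :
    imageNorm f = norm (f (mk [l])) + norm (f (mk [k])) := by
  rw [norm_apply_mk_singleton, norm_apply_mk_singleton, imageNorm]
  obtain ⟨i, b⟩ := l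
  obtain ⟨j, c⟩ := k
  fin_cases i <;> fin_cases j <;> simp at h ⊢
  exact add_comm _ _

theorem exists_signed_permutation {l k : Fin 2 × Bool} (h : l.1 ≠ k.1) :
    ∃ f ∈ signedPrimitiveStabilizer, f (of 0) = mk [l] ∧ f (of 1) = mk [k] := by
  obtain ⟨i, b⟩ := l
  obtain ⟨j, c⟩ := k
  fin_cases i <;> fin_cases j <;> simp at h
  · exact ⟨_, signAut_mem_stabilizer ![b, c], by simp [mk_singleton_eq_cond]⟩
  · exact ⟨_, mul_mem (signAut_mem_stabilizer ![c, b]) swapAut_mem_stabilizer,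
      by simp [mk_singleton_eq_cond]⟩

theorem mulAut_ext_pair {f g : MulAut (FreeGroup (Fin 2))} (h₀ : f (of 0) = g (of 0))
    (h₁ : f (of 1) = g (of 1)) : f = g :=
  MulEquiv.toMonoidHom_injective (hom_ext_pair h₀ h₁)

/-- An automorphism of the free group of rank two whose image lengths cannot be decreased
satisfies the conditions of `length_le_norm_of_cancellation`. -/
theorem cancellation_lt_of_minimal {f : MulAut (FreeGroup (Fin 2))}
    (hf : ∀ g ∈ signedPrimitiveStabilizer, ∀ h ∈ signedPrimitiveStabilizer,
      imageNorm f ≤ imageNorm (g * f * h))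
    (l k k' : Fin 2 × Bool) (hk : k ≠ l) (hk' : k' ≠ (l.1, !l.2)) :
    cancellation (f (mk [l])) (f (mk [k])) + cancellation (f (mk [l]))⁻¹ (f (mk [k'])) <
      norm (f (mk [l])) := by
  have hbar (l : Fin 2 × Bool) : f (mk [(l.1, !l.2)]) = (f (mk [l]))⁻¹ := by
    rw [← _root_.map_inv]; simp [inv_mk, invRev]
  have hne (l : Fin 2 × Bool) : f (mk [l]) ≠ 1 := by
    rw [Ne, ← FreeGroup.norm_eq_zero, norm_apply_mk_singleton, FreeGroup.norm_eq_zero,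
      EmbeddingLike.map_eq_one_iff]
    exact of_ne_one _
  have hB (l : Fin 2 × Bool) := two_mul_cancellation_inv_lt (hne l)
  have hA (l k : Fin 2 × Bool) (h : l.1 ≠ k.1) :
      2 * cancellation (f (mk [l])) (f (mk [k])) ≤ norm (f (mk [l])) := by
    obtain ⟨p, hp, hp0, hp1⟩ := exists_signed_permutation h.symm
    have h1 := hf 1 (one_mem _) (p * (MulAut.conj (of 1)⁻¹ * transvection⁻¹))
      (mul_mem hp (mul_mem (conj_mem_stabilizer _) (inv_mem transvection_mem_stabilizer)))
    rw [imageNorm_eq f h, imageNorm] at h1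
    have h2 := norm_inv_mul_add_cancellation (f (mk [l])) (f (mk [k]))
    simp [hp0, hp1, -mul_mk, -inv_mk, mul_assoc] at h1
    omega
  have hC (l k : Fin 2 × Bool) (h : l.1 ≠ k.1) :
      ¬(2 * cancellation (f (mk [l])) (f (mk [k])) = norm (f (mk [l])) ∧
        2 * cancellation (f (mk [l]))⁻¹ (f (mk [k]))⁻¹ = norm (f (mk [l]))) := by
    rintro ⟨h1, h2⟩
    have h3 := hA k l h.symm
    rw [cancellation_comm] at h3
    obtain ⟨q, hq⟩ := exists_conj_norm_lt (hne l) h1 h2 (by omega)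
    obtain ⟨p, hp, hp0, hp1⟩ := exists_signed_permutation h.symm
    have h4 := hf (MulAut.conj q) (conj_mem_stabilizer _) (p * transvection⁻¹)
      (mul_mem hp (inv_mem transvection_mem_stabilizer))
    rw [imageNorm_eq f h, imageNorm] at h4
    simp [hp0, hp1, -mul_mk, -inv_mk] at h4
    rw [← _root_.map_inv f] at hq
    simp only [mul_assoc, _root_.map_inv] at hq h4
    omega
  have dich (l k : Fin 2 × Bool) : l.1 ≠ k.1 ∨ k = l ∨ k = (l.1, !l.2) := by
    obtain ⟨i, b⟩ := l
    obtain ⟨j, c⟩ := k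
    revert i b j c
    decide
  have hlinv := norm_inv_eq (x := f (mk [l]))
  have e1 : 2 * cancellation (f (mk [l])) (f (mk [k])) ≤ norm (f (mk [l])) ∧
      (l.1 = k.1 → 2 * cancellation (f (mk [l])) (f (mk [k])) < norm (f (mk [l]))) := by
    rcases dich l k with h | rfl | rfl
    · exact ⟨hA l k h, fun h' => absurd h' h⟩
    · exact absurd rfl hk
    · rw [hbar]; exact ⟨(hB l).le, fun _ => hB l⟩
  have e2 : 2 * cancellation (f (mk [l]))⁻¹ (f (mk [k'])) ≤ norm (f (mk [l])) ∧
      (l.1 = k'.1 → 2 * cancellation (f (mk [l]))⁻¹ (f (mk [k'])) < norm (f (mk [l]))) := by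
    rcases dich l k' with h | rfl | rfl
    · refine ⟨?_, fun h' => absurd h' h⟩
      have := hA (l.1, !l.2) k' h
      rwa [hbar, hlinv] at this
    · rw [cancellation_comm]; exact ⟨(hB _).le, fun _ => hB _⟩
    · exact absurd rfl hk'
  by_cases hlk : l.1 = k.1
  · have := e1.2 hlk
    omega
  by_cases hlk' : l.1 = k'.1
  · have := e2.2 hlk'
    omega
  have : k' = k ∨ k' = (k.1, !k.2) := by
    rcases dich k k' with h | h | h
    · omega
    · exact .inl h
    · exact .inr h
  rcases this with rfl | rfl
  · have h1 := min_cancellation_le (f (mk [l])) (f (mk [k'])) (f (mk [l]))⁻¹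
    have h2 := hB l
    rw [cancellation_comm (f (mk [k']))] at h1
    omega
  · have := hC l k hlk
    rw [hbar] at e2 ⊢
    omega

/-- Every automorphism of the free group of rank two preserves the signed primitive elements. -/
theorem mem_signedPrimitiveStabilizer (f : MulAut (FreeGroup (Fin 2))) :
    f ∈ signedPrimitiveStabilizer := by
  induction h : imageNorm f using Nat.strong_induction_on generalizing f with
  | _ n ih =>
    subst h
    by_cases hf : ∀ g ∈ signedPrimitiveStabilizer, ∀ h ∈ signedPrimitiveStabilizer,
      imageNorm f ≤ imageNorm (g * f * h)
    · have key (i : Fin 2) : ∃ l, f⁻¹ (of i) = mk [l] := by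
        have h1 := length_le_norm_of_cancellation f.toMonoidHom (cancellation_lt_of_minimal hf)
          (isReduced_toWord (x := f⁻¹ (of i)))
        rw [mk_toWord] at h1
        have h2 : f.toMonoidHom (f⁻¹ (of i)) = of i := f.apply_symm_apply (of i)
        rw [h2, norm_of] at h1
        have h3 : (f⁻¹ (of i)).toWord ≠ [] := by
          rw [Ne, toWord_eq_nil_iff, EmbeddingLike.map_eq_one_iff]
          exact of_ne_one i
        obtain ⟨l, hl⟩ := List.length_eq_one_iff.1
          (le_antisymm h1 (List.length_pos_iff.2 h3))
        exact ⟨l, by rw [← hl, mk_toWord]⟩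
      obtain ⟨l, hl⟩ := key 0
      obtain ⟨k, hk⟩ := key 1
      have hlk : l.1 ≠ k.1 := by
        intro h
        have : mk [k] = mk [l] ∨ mk [k] = (mk [l])⁻¹ := by
          obtain ⟨i, b⟩ := l
          obtain ⟨j, c⟩ := k
          obtain rfl : i = j := h
          cases b <;> cases c <;> simp [mk_singleton_eq_cond]
        rw [← hl, ← hk, ← _root_.map_inv, f⁻¹.injective.eq_iff, f⁻¹.injective.eq_iff] at this
        rcases this with h | h
        · exact absurd (of_injective h) (by decide)
        · exact absurd (congrArg toWord h) (by simp [toWord_inv, invRev])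
      obtain ⟨p, hp, hp0, hp1⟩ := exists_signed_permutation hlk
      obtain rfl : f⁻¹ = p := mulAut_ext_pair (hl.trans hp0.symm) (hk.trans hp1.symm)
      simpa using hp
    · push Not at hf
      obtain ⟨g, hg, h, hh, hlt⟩ := hf
      have := ih _ hlt (g * f * h) rfl
      rwa [Subgroup.mul_mem_cancel_right _ hh, Subgroup.mul_mem_cancel_left _ hg] at this

end Nielsen

section PrimitiveWords

open FreeGroup

theorem isPrimitiveElement_iff_exists_mulAut {x : FreeGroup (Fin 2)} :
    IsPrimitiveElement x ↔ ∃ f : MulAut (FreeGroup (Fin 2)), f (of 0) = x := by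
  constructor
  · rintro ⟨B, ⟨b, hb⟩, hx⟩
    let e : B ≃ Fin 2 := Equiv.ofFreeGroupEquiv b.repr.symm
    let e' : B ≃ Fin 2 := e.trans (Equiv.swap (e ⟨x, hx⟩) 0)
    have he' : e'.symm 0 = ⟨x, hx⟩ := by rw [Equiv.symm_apply_eq]; simp [e']
    refine ⟨(freeGroupCongr e'.symm).trans b.repr.symm, ?_⟩
    change b.repr.symm (freeGroupCongr e'.symm (of 0)) = x
    rw [freeGroupCongr_apply, map.of, he']
    exact hb ⟨x, hx⟩
  · rintro ⟨f, rfl⟩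
    let b : FreeGroupBasis (Fin 2) (FreeGroup (Fin 2)) := .ofRepr f.symm
    refine ⟨Set.range b, ⟨b.reindex (Equiv.ofInjective b b.injective), ?_⟩, 0, rfl⟩
    rintro ⟨_, i, rfl⟩
    rw [FreeGroupBasis.reindex_apply, Equiv.ofInjective_symm_apply]

/-- The substitutions of letters that generate the primitive words: `a ↦ ab`, the exchange of the
generators, and the inversion of the first generator. -/
def letterSubst : Fin 3 → Fin 2 × Bool → List (Fin 2 × Bool)
  | 0, (0, true) => [(0, true), (1, true)]
  | 0, (0, false) => [(1, false), (0, false)]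
  | 0, (1, b) => [(1, b)]
  | 1, (i, b) => [(i.rev, b)]
  | 2, (0, b) => [(0, !b)]
  | 2, (1, b) => [(1, b)]

/-- The automorphisms induced by `letterSubst`. -/
def letterSubstAut : Fin 3 → MulAut (FreeGroup (Fin 2)) :=
  ![transvection, swapAut, signAut ![false, true]]

theorem mk_cons_eq_mul {α : Type*} (l : α × Bool) (w : List (α × Bool)) :
    FreeGroup.mk (l :: w) = FreeGroup.mk [l] * FreeGroup.mk w := by
  rw [mul_mk]; rfl

theorem mk_flatMap_letterSubst (i : Fin 3) (w : List (Fin 2 × Bool)) :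
    mk (w.flatMap (letterSubst i)) = letterSubstAut i (mk w) := by
  induction w with
  | nil => simp [← one_eq_mk]
  | cons l w ih =>
    rw [List.flatMap_cons, ← mul_mk, ih, mk_cons_eq_mul, _root_.map_mul]
    congr 1
    obtain ⟨j, b⟩ := l
    fin_cases i <;> fin_cases j <;> cases b <;>
      simp [letterSubst, letterSubstAut, mk_singleton_eq_cond, mk_cons_eq_mul _ [_]]

/-- The words generated from a one-letter word by `letterSubst`, rotations and conjugations. -/
abbrev PrimitiveWord : List (Fin 2 × Bool) → Prop :=
  SubstitutionClosure letterSubst (fun l => (l.1, !l.2)) (0, true)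

theorem mk_cons_append_inv (l : Fin 2 × Bool) (w : List (Fin 2 × Bool)) :
    mk (l :: (w ++ [(l.1, !l.2)])) = mk [l] * mk w * (mk [l])⁻¹ := by
  simp [inv_mk, invRev]

theorem PrimitiveWord.exists_mulAut {w : List (Fin 2 × Bool)} (h : PrimitiveWord w) :
    ∃ f : MulAut (FreeGroup (Fin 2)), f (of 0) = mk w := by
  induction h with
  | start => exact ⟨1, rfl⟩
  | subst i _ ih =>
    obtain ⟨f, hf⟩ := ih
    exact ⟨letterSubstAut i * f, by rw [mk_flatMap_letterSubst, ← hf]; rfl⟩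
  | @rotate t w _ ih =>
    obtain ⟨f, hf⟩ := ih
    refine ⟨MulAut.conj (mk [t])⁻¹ * f, ?_⟩
    rw [MulAut.mul_apply, hf, MulAut.conj_apply, mk_cons_eq_mul t w, ← mul_mk]
    group
  | @conj t w _ ih =>
    obtain ⟨f, hf⟩ := ih
    refine ⟨MulAut.conj (mk [t]) * f, ?_⟩
    rw [MulAut.mul_apply, hf, MulAut.conj_apply, mk_cons_append_inv]

theorem PrimitiveWord.rotate_append {u v : List (Fin 2 × Bool)} (h : PrimitiveWord (u ++ v)) :
    PrimitiveWord (v ++ u) := by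
  induction u generalizing v with
  | nil => simpa using h
  | cons l u ih => simpa using ih (v := v ++ [l]) (by simpa using h.rotate)

theorem PrimitiveWord.append_invRev {w : List (Fin 2 × Bool)} (h : PrimitiveWord w)
    (v : List (Fin 2 × Bool)) : PrimitiveWord (v ++ w ++ invRev v) := by
  induction v with
  | nil => simpa using h
  | cons l v ih => simpa [invRev] using ih.conj l

/-- The words in which every generator occurs with the sign prescribed by `e`. -/
def HasSigns (e : Fin 2 → Bool) (w : List (Fin 2 × Bool)) : Prop := ∀ l ∈ w, l.2 = e l.1

theorem HasSigns.isReduced {e : Fin 2 → Bool} {w : List (Fin 2 × Bool)} (h : HasSigns e w) :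
    IsReduced w := by
  induction w with
  | nil => exact .nil
  | cons l w ih =>
    refine List.isChain_cons.2 ⟨fun k hk hlk => ?_, ih fun k hk => h k (by simp [hk])⟩
    rw [h l (by simp), h k (by simp [List.mem_of_mem_head? hk]), hlk]

theorem HasSigns.letterSubst {e e' : Fin 2 → Bool} {w : List (Fin 2 × Bool)} (h : HasSigns e w)
    (i : Fin 3) (he : ∀ j, HasSigns e' (letterSubst i (j, e j))) :
    HasSigns e' (w.flatMap (letterSubst i)) := by
  intro k hk
  obtain ⟨⟨j, b⟩, hl, hk⟩ := List.mem_flatMap.1 hk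
  obtain rfl : b = e j := h _ hl
  exact he j k hk

theorem IsPositivePrimitive.exists_word {x : FreeGroup (Fin 2)} (h : IsPositivePrimitive x) :
    ∃ w, PrimitiveWord w ∧ HasSigns (fun _ => true) w ∧ mk w = x := by
  induction h with
  | of_zero => exact ⟨_, .start, by simp [HasSigns], rfl⟩
  | transvection _ ih =>
    obtain ⟨w, hw, hs, rfl⟩ := ih
    exact ⟨_, hw.subst 0, hs.letterSubst 0 (by unfold HasSigns; decide),
      mk_flatMap_letterSubst 0 w⟩
  | swap _ ih =>
    obtain ⟨w, hw, hs, rfl⟩ := ih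
    exact ⟨_, hw.subst 1, hs.letterSubst 1 (by unfold HasSigns; decide),
      mk_flatMap_letterSubst 1 w⟩

theorem PrimitiveWord.exists_signs {w : List (Fin 2 × Bool)} (h : PrimitiveWord w)
    (hs : HasSigns (fun _ => true) w) (e : Fin 2 → Bool) :
    ∃ w', PrimitiveWord w' ∧ HasSigns e w' ∧ mk w' = letterSignHom e (mk w) := by
  have flip {e : Fin 2 → Bool} {x : FreeGroup (Fin 2)}
      (h : ∃ w', PrimitiveWord w' ∧ HasSigns e w' ∧ mk w' = x) :
      ∃ w', PrimitiveWord w' ∧ HasSigns ![!e 0, e 1] w' ∧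
        mk w' = letterSignHom ![false, true] x := by
    obtain ⟨w, hw, hs, rfl⟩ := h
    refine ⟨_, hw.subst 2, hs.letterSubst 2 ?_, mk_flatMap_letterSubst 2 w⟩
    intro j
    fin_cases j <;> simp [HasSigns, _root_.letterSubst]
  have swap {e : Fin 2 → Bool} {x : FreeGroup (Fin 2)}
      (h : ∃ w', PrimitiveWord w' ∧ HasSigns e w' ∧ mk w' = x) :
      ∃ w', PrimitiveWord w' ∧ HasSigns ![e 1, e 0] w' ∧ mk w' = swapAut x := by
    obtain ⟨w, hw, hs, rfl⟩ := h
    refine ⟨_, hw.subst 1, hs.letterSubst 1 ?_, mk_flatMap_letterSubst 1 w⟩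
    intro j
    fin_cases j <;> simp [HasSigns, _root_.letterSubst]
  have h00 : ∃ w', PrimitiveWord w' ∧ HasSigns (fun _ => true) w' ∧ mk w' = mk w :=
    ⟨w, h, hs, rfl⟩
  have key {e' : Fin 2 → Bool} {x : FreeGroup (Fin 2)} (he : e' = e)
      (hx : x = letterSignHom e (mk w))
      (h : ∃ w', PrimitiveWord w' ∧ HasSigns e' w' ∧ mk w' = x) :
      ∃ w', PrimitiveWord w' ∧ HasSigns e w' ∧ mk w' = letterSignHom e (mk w) := by
    rwa [he, hx] at h
  have hcases : e = ![e 0, e 1] := by ext j; fin_cases j <;> rfl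
  cases h0 : e 0 <;> cases h1 : e 1 <;> rw [h0, h1] at hcases <;> subst hcases
  · refine key ?_ ?_ (flip (swap (flip (swap h00))))
    · decide
    · rw [swapAut_letterSignHom, letterSignHom_letterSignHom, swapAut_swapAut]
      congr 2; decide
  · refine key ?_ ?_ (flip h00)
    · decide
    · rfl
  · refine key ?_ ?_ (swap (flip (swap h00)))
    · decide
    · rw [swapAut_letterSignHom, swapAut_swapAut]; rfl
  · refine key ?_ ?_ h00
    · decide
    · exact (letterSignHom_true _).symm.trans (by congr 2; decide)

/-- The reduced word of a conjugate of a cyclically reduced primitive word is generated. -/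
theorem PrimitiveWord.toWord_conj {e : Fin 2 → Bool} {c v : List (Fin 2 × Bool)}
    (hc : PrimitiveWord c) (hs : HasSigns e c) (hv : IsReduced v) :
    PrimitiveWord (mk v * mk c * (mk v)⁻¹).toWord := by
  induction v using List.reverseRecOn generalizing c with
  | nil => simpa [← one_eq_mk, hs.isReduced.reduce_eq] using hc
  | append_singleton v l ih =>
    have hv' : IsReduced v := hv.infix (List.prefix_append _ _).isInfix
    by_cases h1 : ∃ c', c = (l.1, !l.2) :: c'
    · obtain ⟨c', rfl⟩ := h1
      have := ih hc.rotate (fun k hk => hs k (by simpa [or_comm] using hk)) hv'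
      convert this using 2
      have : mk ((l.1, !l.2) :: c') = (mk [l])⁻¹ * mk c' := by simp [inv_mk, invRev]
      have h' : mk (c' ++ [(l.1, !l.2)]) = mk c' * (mk [l])⁻¹ := by simp [inv_mk, invRev]
      rw [this, h', ← mul_mk]
      group
    by_cases h2 : ∃ c', c = c' ++ [l]
    · obtain ⟨c', rfl⟩ := h2
      have := ih hc.rotate_append (fun k hk => hs k (by simpa [or_comm] using hk)) hv'
      convert this using 2
      rw [← mul_mk, ← mul_mk, ← mul_mk]
      group
    · have hc0 : c ≠ [] := by
        rintro rfl
        obtain ⟨f, hf⟩ := hc.exists_mulAut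
        rw [← one_eq_mk, EmbeddingLike.map_eq_one_iff] at hf
        exact of_ne_one _ hf
      have hred : IsReduced (v ++ [l] ++ c ++ invRev (v ++ [l])) := by
        refine IsReduced.append_overlap ?_ ?_ hc0
        · refine IsReduced.append_overlap hv ?_ (by simp)
          refine List.isChain_cons.2 ⟨fun k hk hlk => ?_, hs.isReduced⟩
          by_contra h
          refine h1 ⟨c.tail, ?_⟩
          obtain ⟨c', rfl⟩ := List.head?_eq_some_iff.1 hk
          simp only [List.tail_cons, List.cons.injEq, and_true]
          exact Prod.ext hlk.symm (by cases h3 : k.2 <;> cases h4 : l.2 <;> simp_all)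
        · have hinv : IsReduced (invRev (v ++ [l])) := by
            rw [isReduced_iff_reduce_eq, reduce_invRev, hv.reduce_eq]
          refine List.isChain_append.2 ⟨hs.isReduced, hinv, ?_⟩
          intro k hk m hm hkm
          obtain rfl : (l.1, !l.2) = m := by simpa [invRev] using hm
          by_contra h
          obtain ⟨c', rfl⟩ := List.getLast?_eq_some_iff.1 hk
          exact h2 ⟨c', by
            simp only [List.append_cancel_left_eq, List.cons.injEq, and_true]
            exact Prod.ext hkm (by cases h3 : k.2 <;> cases h4 : l.2 <;> simp_all)⟩
      rw [inv_mk, mul_mk, mul_mk, toWord_mk, hred.reduce_eq]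
      exact hc.append_invRev _

theorem mem_reducedPrimitiveWords_iff {w : List (Fin 2 × Bool)} :
    w ∈ reducedPrimitiveWords ↔ PrimitiveWord w ∧ IsReduced w := by
  constructor
  · rintro ⟨x, hx, rfl⟩
    refine ⟨?_, isReduced_toWord⟩
    obtain ⟨f, rfl⟩ := isPrimitiveElement_iff_exists_mulAut.1 hx
    obtain ⟨g, e, y, hy, hfy⟩ := (mem_signedPrimitiveStabilizer f _).2
      (IsSignedPrimitive.of_positive .of_zero)
    obtain ⟨c, hc, hs, rfl⟩ := hy.exists_word
    obtain ⟨c', hc', hs', hcc'⟩ := hc.exists_signs hs e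
    rw [hfy, ← hcc', ← mk_toWord (x := g)]
    exact hc'.toWord_conj hs' isReduced_toWord
  · rintro ⟨hw, hr⟩
    obtain ⟨f, hf⟩ := hw.exists_mulAut
    exact ⟨mk w, isPrimitiveElement_iff_exists_mulAut.2 ⟨f, hf⟩, by
      rw [toWord_mk, hr.reduce_eq]⟩

end PrimitiveWords

theorem mainTheorem9 : reducedPrimitiveWords.IsContextSensitive := by
  have h : reducedPrimitiveWords = {w | SubstitutionClosure letterSubst (fun l => (l.1, !l.2))
      (0, true) w ∧ w.IsChain fun a b => a.1 = b.1 → a.2 = b.2} :=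
    Set.ext fun w => mem_reducedPrimitiveWords_iff
  rw [h]
  exact SubstitutionClosure.isContextSensitive (by decide)
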